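/- Fix a domain $\mathbf{Dia}$ of diagrams: a full sub-2-category of the 2-category $\mathbf{Cat}$ of small categories, closed under isomorphism, binary products and the slices $J_{/k}$, $J_{k/}$ of functors $u\colon J\to K$ in $\mathbf{Dia}$, and containing the final category $e$ and the posets $V$ and $\partial V$ below (for instance $\mathbf{Cat}$ itself, or all posets). A prederivator $\mathbb D$ is a strict 2-functor $\mathbf{Dia}^{\mathrm{op}}\to\mathbf{CAT}$, written $K\mapsto\mathbb D(K)$, $u\mapsto u^*$, $\alpha\mapsto\alpha^*$ (it reverses functors and keeps the direction of natural transformations). It is a derivator if (Der1) $\mathbb D(\coprod_i K_i)\to\prod_i\mathbb D(K_i)$ is an equivalence for every small family of categories in $\mathbf{Dia}$ whose coproduct is in $\mathbf{Dia}$; (Der2) a morphism $f$ of $\mathbb D(K)$ is an isomorphism if and only if $k^*f$ is one for every object $k$ of $K$, viewed as a functor $k\colon e\to K$; (Der3) every $u^*$ has a left adjoint $u_!$ and a right adjoint $u_*$; (Der4) for all $u\colon J\to K$ and $k\in K$, the canonical mates $\pi_!\,\mathrm{pr}^*\to k^*u_!$ (for $J_{/k}$, with projections $\mathrm{pr}\colon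 J_{/k}\to J$ and $\pi\colon J_{/k}\to e$) and $k^*u_*\to\pi_*\,\mathrm{pr}^*$ (for $J_{k/}$) are isomorphisms. A derivator $\mathbb D$ is pointed if $\mathbb D(e)$ has a zero object. It is regular if filtered colimits commute with finite limits, that is, for every filtered category $C$ and every finite category $E$ in $\mathbf{Dia}$, with projections $\pi_C,\pi_E$ to $e$, and every $Y\in\mathbb D(C\times E)$, the canonical morphism $$\pi_{C,!}(\mathrm{id}_C\times\pi_E)_*Y\longrightarrow\pi_{E,*}(\pi_C\times\mathrm{id}_E)_!Y$$ is an isomorphism. Here "finite category" may be read either as a category with finitely many objects and morphisms, or as a finite direct category (one whose nerve has finitely many nondegenerate simplices). Let $V\subset\mathbb Z^2$ be the full subposet of all $(i,j)$ with $|i-j|\le 1$, and $\partial V\subset V$ the full subposet of all $(i,j)$ with $|i-j|=1$, with inclusion $\iota\colon\partial V\to V$. For a pointed derivator $\mathbb D$, let $\operatorname{Sp}\mathbb D$ be the prederivator for which $\operatorname{Sp}\mathbb D(K)$ is the full subcategory of $\mathbb D(V\times K)$ on the objects $X$ with $(\iota\times\mathrm{id}_K)^*X=0$ in $\mathbb D(\partial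 V\times K)$, with restrictions $(\mathrm{id}_V\times u)^*$. **Proposition.** For each of the two readings of "finite category": if $\mathbb D$ is a regular pointed derivator, then $\operatorname{Sp}\mathbb D$ is again a regular pointed derivator, with the same reading of "finite category". -/

import Mathlib

open CategoryTheory CategoryTheory.Limits

universe u v w

/-! ### Diagram shapes

`V` is the full subcategory of the poset `ℤ × ℤ` on the pairs `(i, j)` with `|i - j| ≤ 1`, and
`∂V` is its full subcategory on the pairs with `|i - j| = 1`. -/

/-- The set of pairs of integers `(i, j)` with `|i - j| ≤ 1`. -/
@[ext]
structure VShape : Type u where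
  i : ℤ
  j : ℤ
  near : |i - j| ≤ 1

namespace VShape

/-- The order induced from the componentwise order of `ℤ × ℤ`. -/
noncomputable instance : PartialOrder VShape.{u} :=
  PartialOrder.lift (fun p => (p.i, p.j)) (fun p q h => by
    have h' := Prod.mk.inj h
    exact VShape.ext h'.1 h'.2)

/-- The pairs `(i, j)` with `|i - j| = 1`. -/
def boundary : ObjectProperty VShape.{u} := fun p => |p.i - p.j| = 1

end VShape

/-- A domain of diagrams: a full sub-2-category `Dia` of the 2-category of small categories, given
by its class of objects, which is closed under isomorphism and has the shapes that are needed to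
state the axioms of a derivator and to define prespectra: the final category, the slices `J_{/k}`
and `J_{k/}` of functors of `Dia`, binary products, and the posets `V` and `∂V`.  All small
categories form a domain, and so do all posets. -/
structure DiagramDomain where
  mem : (K : Type u) → [Category.{u} K] → Prop
  mem_of_iso : ∀ (J K : Type u) [Category.{u} J] [Category.{u} K] (F : J ⥤ K) (G : K ⥤ J),
    F ⋙ G = 𝟭 J → G ⋙ F = 𝟭 K → mem J → mem K
  mem_final : mem (Discrete PUnit.{u + 1})
  mem_prod : ∀ (J K : Type u) [Category.{u} J] [Category.{u} K], mem J → mem K → mem (J × K)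
  mem_sliceOver : ∀ (J K : Type u) [Category.{u} J] [Category.{u} K] (F : J ⥤ K) (k : K),
    mem J → mem K → mem (CostructuredArrow F k)
  mem_sliceUnder : ∀ (J K : Type u) [Category.{u} J] [Category.{u} K] (F : J ⥤ K) (k : K),
    mem J → mem K → mem (StructuredArrow k F)
  mem_V : mem VShape.{u}
  mem_boundary : mem VShape.boundary.{u}.FullSubcategory

namespace DiagramDomain

/-- The objects of a domain of diagrams. -/
structure Shape (Dia : DiagramDomain.{u}) where
  carrier : Type u
  [cat : Category.{u} carrier]
  isMem : Dia.mem carrier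

variable {Dia : DiagramDomain.{u}}

instance : CoeSort Dia.Shape (Type u) := ⟨Shape.carrier⟩

instance (K : Dia.Shape) : Category.{u} K := K.cat

namespace Shape

/-- The final category `e`. -/
abbrev final (Dia : DiagramDomain.{u}) : Dia.Shape := ⟨Discrete PUnit.{u + 1}, Dia.mem_final⟩

/-- The product `J × K`. -/
abbrev prod (J K : Dia.Shape) : Dia.Shape := ⟨J × K, Dia.mem_prod J K J.isMem K.isMem⟩

/-- The slice `J_{/k}`, with objects `(j, u j ⟶ k)`. -/
abbrev sliceOver {J K : Dia.Shape} (F : J ⥤ K) (k : K) : Dia.Shape :=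
  ⟨CostructuredArrow F k, Dia.mem_sliceOver J K F k J.isMem K.isMem⟩

/-- The slice `J_{k/}`, with objects `(j, k ⟶ u j)`. -/
abbrev sliceUnder {J K : Dia.Shape} (F : J ⥤ K) (k : K) : Dia.Shape :=
  ⟨StructuredArrow k F, Dia.mem_sliceUnder J K F k J.isMem K.isMem⟩

/-- The projection `J_{/k} ⥤ J`. -/
abbrev prOver {J K : Dia.Shape} (F : J ⥤ K) (k : K) : sliceOver F k ⥤ J :=
  CostructuredArrow.proj F k

/-- The projection `J_{k/} ⥤ J`. -/
abbrev prUnder {J K : Dia.Shape} (F : J ⥤ K) (k : K) : sliceUnder F k ⥤ J :=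
  StructuredArrow.proj k F

/-- The disjoint union of a family of shapes, when it belongs to the domain. -/
abbrev coprod {ι : Type u} (K : ι → Dia.Shape) (h : Dia.mem (Σ i, (K i : Type u))) : Dia.Shape :=
  ⟨Σ i, (K i : Type u), h⟩

/-- The inclusion of a summand in a disjoint union. -/
abbrev incl {ι : Type u} (K : ι → Dia.Shape) (h : Dia.mem (Σ i, (K i : Type u))) (i : ι) :
    K i ⥤ coprod K h :=
  CategoryTheory.Sigma.incl (C := fun i => (K i : Type u)) i

/-- The product `u × v` of two functors. -/
abbrev prodMap {I J K L : Dia.Shape} (F : I ⥤ J) (G : K ⥤ L) : prod I K ⥤ prod J L :=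
  Functor.prod F G

/-- The first projection `J × K ⥤ J`, that is `id_J × π_K`. -/
abbrev fst (J K : Dia.Shape) : prod J K ⥤ J := CategoryTheory.Prod.fst J K

/-- The second projection `J × K ⥤ K`, that is `π_J × id_K`. -/
abbrev snd (J K : Dia.Shape) : prod J K ⥤ K := CategoryTheory.Prod.snd J K

/-- The poset `V`. -/
noncomputable abbrev V (Dia : DiagramDomain.{u}) : Dia.Shape := ⟨VShape.{u}, Dia.mem_V⟩

/-- The poset `∂V`. -/
noncomputable abbrev boundaryV (Dia : DiagramDomain.{u}) : Dia.Shape :=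
  ⟨VShape.boundary.{u}.FullSubcategory, Dia.mem_boundary⟩

/-- The projection `π_K : K ⥤ e`. -/
abbrev proj (K : Dia.Shape) : K ⥤ final Dia := Functor.star K

/-- The functor `k : e ⥤ K` that classifies an object `k` of `K`. -/
abbrev point {K : Dia.Shape} (k : K) : final Dia ⥤ K := Functor.fromPUnit k

/-- A finite category: it has finitely many objects and finitely many morphisms. -/
def IsFinite (K : Dia.Shape) : Prop := Nonempty (FinCategory K)

/-- A finite direct category: its nerve has finitely many nondegenerate simplices. -/
def IsFiniteDirect (K : Dia.Shape) : Prop := (nerve K).Finite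

end Shape

end DiagramDomain

open DiagramDomain

/-! ### Prederivators and derivators -/

set_option linter.checkUnivs false in
/-- A prederivator with domain `Dia`: a strict 2-functor from `Dia` to the 2-category of categories
that reverses functors and keeps the direction of natural transformations.  `pull u` is `u^*`, and
`pullMap α` is `α^*`. -/
structure Prederivator (Dia : DiagramDomain.{u}) where
  obj : Dia.Shape → Type w
  [cat : ∀ K, Category.{v} (obj K)]
  pull : ∀ {J K : Dia.Shape}, (J ⥤ K) → (obj K ⥤ obj J)
  pullMap : ∀ {J K : Dia.Shape} {F G : J ⥤ K}, (F ⟶ G) → (pull F ⟶ pull G)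
  pull_id : ∀ K : Dia.Shape, pull (𝟭 K) = 𝟭 (obj K)
  pull_comp : ∀ {I J K : Dia.Shape} (F : I ⥤ J) (G : J ⥤ K), pull (F ⋙ G) = pull G ⋙ pull F
  pullMap_id : ∀ {J K : Dia.Shape} (F : J ⥤ K), pullMap (𝟙 F) = 𝟙 (pull F)
  pullMap_comp : ∀ {J K : Dia.Shape} {F G H : J ⥤ K} (α : F ⟶ G) (β : G ⟶ H),
    pullMap (α ≫ β) = pullMap α ≫ pullMap β
  pullMap_whiskerLeft : ∀ {I J K : Dia.Shape} (F : I ⥤ J) {G H : J ⥤ K} (α : G ⟶ H),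
    pullMap (Functor.whiskerLeft F α) =
      eqToHom (pull_comp F G) ≫ Functor.whiskerRight (pullMap α) (pull F) ≫
        eqToHom (pull_comp F H).symm
  pullMap_whiskerRight : ∀ {I J K : Dia.Shape} {F G : I ⥤ J} (α : F ⟶ G) (H : J ⥤ K),
    pullMap (Functor.whiskerRight α H) =
      eqToHom (pull_comp F H) ≫ Functor.whiskerLeft (pull H) (pullMap α) ≫
        eqToHom (pull_comp G H).symm

namespace Prederivator

variable {Dia : DiagramDomain.{u}} (D : Prederivator.{u, v, w} Dia)

instance (K : Dia.Shape) : Category.{v} (D.obj K) := D.cat K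

/-- (Der3) For every functor `u` of `Dia`, `u^*` has a left adjoint and a right adjoint. -/
class HasKanExtensions : Prop where
  isRightAdjoint : ∀ {J K : Dia.Shape} (F : J ⥤ K), (D.pull F).IsRightAdjoint
  isLeftAdjoint : ∀ {J K : Dia.Shape} (F : J ⥤ K), (D.pull F).IsLeftAdjoint

instance [D.HasKanExtensions] {J K : Dia.Shape} (F : J ⥤ K) : (D.pull F).IsRightAdjoint :=
  HasKanExtensions.isRightAdjoint F

instance [D.HasKanExtensions] {J K : Dia.Shape} (F : J ⥤ K) : (D.pull F).IsLeftAdjoint :=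
  HasKanExtensions.isLeftAdjoint F

/-- A square of functors with a natural transformation `F ⋙ G ⟶ F' ⋙ G'` gives a natural
transformation between the composites of the restriction functors. -/
def square {I J J' K : Dia.Shape} {F : I ⥤ J} {G : J ⥤ K} {F' : I ⥤ J'} {G' : J' ⥤ K}
    (α : F ⋙ G ⟶ F' ⋙ G') : D.pull G ⋙ D.pull F ⟶ D.pull G' ⋙ D.pull F' :=
  eqToHom (D.pull_comp F G).symm ≫ D.pullMap α ≫ eqToHom (D.pull_comp F' G')

section Kan

variable [D.HasKanExtensions]

/-- The left Kan extension `u_!`. -/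
noncomputable def lan {J K : Dia.Shape} (F : J ⥤ K) : D.obj J ⥤ D.obj K :=
  (D.pull F).leftAdjoint

/-- The adjunction between `u_!` and `u^*`. -/
noncomputable def lanAdj {J K : Dia.Shape} (F : J ⥤ K) : D.lan F ⊣ D.pull F :=
  Adjunction.ofIsRightAdjoint (D.pull F)

/-- The right Kan extension `u_*`. -/
noncomputable def ran {J K : Dia.Shape} (F : J ⥤ K) : D.obj J ⥤ D.obj K :=
  (D.pull F).rightAdjoint

/-- The adjunction between `u^*` and `u_*`. -/
noncomputable def ranAdj {J K : Dia.Shape} (F : J ⥤ K) : D.pull F ⊣ D.ran F :=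
  Adjunction.ofIsLeftAdjoint (D.pull F)

/-- The left mate `F'_! F^* ⟶ G'^* G_!` (composition of functors written classically) of a natural
transformation `F ⋙ G ⟶ F' ⋙ G'`. -/
noncomputable def leftMate {I J J' K : Dia.Shape} {F : I ⥤ J} {G : J ⥤ K} {F' : I ⥤ J'}
    {G' : J' ⥤ K} (α : F ⋙ G ⟶ F' ⋙ G') : D.pull F ⋙ D.lan F' ⟶ D.lan G ⋙ D.pull G' :=
  ((mateEquiv (D.lanAdj G) (D.lanAdj F')).symm (TwoSquare.mk _ _ _ _ (D.square α))).natTrans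

/-- The right mate `G^* G'_* ⟶ F_* F'^*` (composition of functors written classically) of a natural
transformation `F ⋙ G ⟶ F' ⋙ G'`. -/
noncomputable def rightMate {I J J' K : Dia.Shape} {F : I ⥤ J} {G : J ⥤ K} {F' : I ⥤ J'}
    {G' : J' ⥤ K} (α : F ⋙ G ⟶ F' ⋙ G') : D.ran G' ⋙ D.pull G ⟶ D.pull F' ⋙ D.ran F :=
  (mateEquiv (D.ranAdj G') (D.ranAdj F) (TwoSquare.mk _ _ _ _ (D.square α))).natTrans

end Kan

/-- The 2-cell that fills the square of the slice `J_{/k}`. -/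
def overCell {J K : Dia.Shape} (F : J ⥤ K) (k : K) :
    Shape.prOver F k ⋙ F ⟶ Shape.proj (Shape.sliceOver F k) ⋙ Shape.point k where
  app x := x.hom
  naturality _ _ f := (CostructuredArrow.w f).trans (Category.comp_id _).symm

/-- The 2-cell that fills the square of the slice `J_{k/}`. -/
def underCell {J K : Dia.Shape} (F : J ⥤ K) (k : K) :
    Shape.proj (Shape.sliceUnder F k) ⋙ Shape.point k ⟶ Shape.prUnder F k ⋙ F where
  app x := x.hom
  naturality _ _ f := (Category.id_comp _).trans (StructuredArrow.w f).symm

/-- The axioms (Der1) to (Der4) of a derivator; (Der3) is the parent class.  (Der1) is about every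
family of shapes whose disjoint union is again a shape of the domain. -/
class IsDerivator : Prop extends D.HasKanExtensions where
  der1 : ∀ (ι : Type u) (K : ι → Dia.Shape) (h : Dia.mem (Σ i, (K i : Type u))),
    (Functor.pi' fun i => D.pull (Shape.incl K h i)).IsEquivalence
  der2 : ∀ (K : Dia.Shape) {X Y : D.obj K} (f : X ⟶ Y),
    IsIso f ↔ ∀ k : K, IsIso ((D.pull (Shape.point k)).map f)
  der4_left : ∀ {J K : Dia.Shape} (F : J ⥤ K) (k : K),
    IsIso (D.leftMate (F := Shape.prOver F k) (G := F) (F' := Shape.proj (Shape.sliceOver F k))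
      (G' := Shape.point k) (overCell F k))
  der4_right : ∀ {J K : Dia.Shape} (F : J ⥤ K) (k : K),
    IsIso (D.rightMate (F := Shape.proj (Shape.sliceUnder F k)) (G := Shape.point k)
      (F' := Shape.prUnder F k) (G' := F) (underCell F k))

/-- A derivator is pointed if its base has a zero object. -/
def IsPointed : Prop := HasZeroObject (D.obj (Shape.final Dia))

/-! ### Regularity -/

section Regular

variable [D.HasKanExtensions] (C E : Dia.Shape)

/-- The left mate `(π_C × id_E)_! (id_C × π_E)^* ⟶ π_E^* π_{C,!}` of the commutative square of the
projections of `C × E`.  It is an isomorphism in every derivator. -/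
noncomputable def baseChange :
    D.pull (Shape.fst C E) ⋙ D.lan (Shape.snd C E) ⟶ D.lan (Shape.proj C) ⋙ D.pull (Shape.proj E) :=
  D.leftMate (F := Shape.fst C E) (G := Shape.proj C) (F' := Shape.snd C E) (G' := Shape.proj E)
    (𝟙 (Shape.fst C E ⋙ Shape.proj C))

/-- `c` is the canonical morphism `π_{C,!} (id_C × π_E)_* Y ⟶ π_{E,*} (π_C × id_E)_! Y`: its
transpose `π_E^* π_{C,!} (id_C × π_E)_* Y ⟶ (π_C × id_E)_! Y` becomes, after the base change
isomorphism, the morphism that the left Kan extension along `π_C × id_E` makes of the counit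
`(id_C × π_E)^* (id_C × π_E)_* Y ⟶ Y`.  As `baseChange` is invertible in a derivator, there is
exactly one such morphism. -/
def IsCanonical (Y : D.obj (Shape.prod C E))
    (c : (D.lan (Shape.proj C)).obj ((D.ran (Shape.fst C E)).obj Y) ⟶
      (D.ran (Shape.proj E)).obj ((D.lan (Shape.snd C E)).obj Y)) : Prop :=
  (D.baseChange C E).app ((D.ran (Shape.fst C E)).obj Y) ≫
      ((D.ranAdj (Shape.proj E)).homEquiv _ _).symm c =
    (D.lan (Shape.snd C E)).map ((D.ranAdj (Shape.fst C E)).counit.app Y)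

end Regular

/-- A derivator is regular if colimits over filtered shapes commute with limits over finite shapes,
that is, the canonical morphism is an isomorphism.  `Fin` says which shapes count as finite. -/
def IsRegular [D.HasKanExtensions] (Fin : Dia.Shape → Prop) : Prop :=
  ∀ (C E : Dia.Shape), IsFiltered C → Fin E → ∀ Y : D.obj (Shape.prod C E),
    ∃ c, D.IsCanonical C E Y c ∧ IsIso c

/-- Regular pointed derivators. -/
structure IsRegularPointedDerivator (Fin : Dia.Shape → Prop) : Prop extends D.IsDerivator where
  isPointed : D.IsPointed
  isRegular : D.IsRegular Fin

/-! ### Vanishing subderivators and prespectra -/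

/-- Restriction functors preserve zero objects, as they have adjoints on both sides. -/
theorem isZero_pull [D.HasKanExtensions] {J K : Dia.Shape} (F : J ⥤ K) {X : D.obj K}
    (hX : IsZero X) : IsZero ((D.pull F).obj X) where
  unique_to Y := by
    obtain ⟨h⟩ := hX.unique_to ((D.ran F).obj Y)
    exact ⟨((D.ranAdj F).homEquiv X Y).unique⟩
  unique_from Y := by
    obtain ⟨h⟩ := hX.unique_from ((D.lan F).obj Y)
    exact ⟨((D.lanAdj F).homEquiv Y X).symm.unique⟩

/-- Functors to a full subcategory are equal if their composites with the inclusion are equal. -/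
theorem functor_ext_of_comp_ι {C : Type*} [Category C] {E : Type*} [Category E]
    {P : ObjectProperty E} {F G : C ⥤ P.FullSubcategory} (h : F ⋙ P.ι = G ⋙ P.ι) : F = G := by
  refine CategoryTheory.Functor.ext (fun X => ObjectProperty.FullSubcategory.ext (Functor.congr_obj h X)) ?_
  intro X Y f
  apply P.ι.map_injective
  simpa [eqToHom_map P.ι] using Functor.congr_hom h f

/-- The inclusion of a full subcategory sends the components of `eqToHom` to those of `eqToHom`. -/
theorem eqToHom_app_hom {C : Type*} [Category C] {E : Type*} [Category E]
    {P : ObjectProperty E} {F G : C ⥤ P.FullSubcategory} (h : F = G) (X : C) :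
    ((eqToHom h).app X).hom =
      eqToHom (congrArg (fun H : C ⥤ P.FullSubcategory => (H.obj X).obj) h) := by
  subst h
  rfl

section Vanishing

variable [D.HasKanExtensions] {A B : Dia.Shape} (i : A ⥤ B)

/-- The objects `X` of `D(B × K)` with `(i × id_K)^* X = 0`. -/
def vanishes (K : Dia.Shape) : ObjectProperty (D.obj (Shape.prod B K)) := fun X =>
  IsZero ((D.pull (Shape.prodMap i (𝟭 K))).obj X)

/-- The natural transformation `id_B × α`. -/
abbrev idProdMap (B : Dia.Shape) {J K : Dia.Shape} {F G : J ⥤ K} (α : F ⟶ G) :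
    Shape.prodMap (𝟭 B) F ⟶ Shape.prodMap (𝟭 B) G :=
  NatTrans.prod (𝟙 (𝟭 B)) α

theorem vanishes_pull {J K : Dia.Shape} (F : J ⥤ K) {X : D.obj (Shape.prod B K)}
    (hX : D.vanishes i K X) : D.vanishes i J ((D.pull (Shape.prodMap (𝟭 B) F)).obj X) := by
  have h := D.isZero_pull (Shape.prodMap (𝟭 A) F) hX
  have e : D.pull (Shape.prodMap i (𝟭 K)) ⋙
      D.pull (Shape.prodMap (𝟭 A) F) = D.pull (Shape.prodMap (𝟭 B) F) ⋙
        D.pull (Shape.prodMap i (𝟭 J)) := by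
    rw [← D.pull_comp, ← D.pull_comp]
    rfl
  exact (congrArg IsZero (Functor.congr_obj e X)).mp h

/-- The prederivator `D^{B,A}` of the objects that vanish on `A`, for `i : A ⥤ B` the inclusion of a
full subcategory: its value at `K` is the full subcategory of `D(B × K)` on the objects `X` with
`(i × id_K)^* X = 0`. -/
def vanishing : Prederivator.{u, v, w} Dia where
  obj K := (D.vanishes i K).FullSubcategory
  pull {J K} F := (D.vanishes i J).lift ((D.vanishes i K).ι ⋙ D.pull (Shape.prodMap (𝟭 B) F))
    fun X => D.vanishes_pull i F X.property
  pullMap {J K F G} α :=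
    { app := fun X => ObjectProperty.homMk ((D.pullMap (idProdMap B α)).app X.obj)
      naturality := fun X Y f => by
        ext
        exact (D.pullMap (idProdMap B α)).naturality f.hom }
  pull_id K := by
    apply functor_ext_of_comp_ι
    change (D.vanishes i K).ι ⋙ D.pull (𝟭 (Shape.prod B K)) = (D.vanishes i K).ι
    rw [D.pull_id]
    rfl
  pull_comp {I J K} F G := by
    apply functor_ext_of_comp_ι
    change (D.vanishes i K).ι ⋙ D.pull (Shape.prodMap (𝟭 B) F ⋙ Shape.prodMap (𝟭 B) G) =
      (D.vanishes i K).ι ⋙ D.pull (Shape.prodMap (𝟭 B) G) ⋙ D.pull (Shape.prodMap (𝟭 B) F)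
    rw [D.pull_comp]
  pullMap_id F := by
    ext X
    exact NatTrans.congr_app (D.pullMap_id (Shape.prodMap (𝟭 B) F)) X.obj
  pullMap_comp α β := by
    ext X
    have e : idProdMap B (α ≫ β) = idProdMap B α ≫ idProdMap B β := by
      ext x <;> simp
    exact (NatTrans.congr_app ((congrArg D.pullMap e).trans (D.pullMap_comp _ _)) X.obj)
  pullMap_whiskerLeft {I J K} F {G H} α := by
    ext X
    have e : idProdMap B (Functor.whiskerLeft F α) =
        Functor.whiskerLeft (Shape.prodMap (𝟭 B) F) (idProdMap B α) := rfl
    have h := NatTrans.congr_app ((congrArg D.pullMap e).trans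
      (D.pullMap_whiskerLeft (Shape.prodMap (𝟭 B) F) (idProdMap B α))) X.obj
    simp only [NatTrans.comp_app, eqToHom_app] at h
    simp only [NatTrans.comp_app, ObjectProperty.FullSubcategory.comp_hom, eqToHom_app_hom]
    exact h
  pullMap_whiskerRight {I J K} {F G} α H := by
    ext X
    have e : idProdMap B (Functor.whiskerRight α H) =
        Functor.whiskerRight (idProdMap B α) (Shape.prodMap (𝟭 B) H) := by
      ext x <;> simp
    have h := NatTrans.congr_app ((congrArg D.pullMap e).trans
      (D.pullMap_whiskerRight (idProdMap B α) (Shape.prodMap (𝟭 B) H))) X.obj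
    simp only [NatTrans.comp_app, eqToHom_app] at h
    simp only [NatTrans.comp_app, ObjectProperty.FullSubcategory.comp_hom, eqToHom_app_hom]
    exact h

end Vanishing

/-- The prederivator `Sp D = D^{V,∂V}` of prespectrum objects of `D`. -/
noncomputable def Sp [D.HasKanExtensions] : Prederivator.{u, v, w} Dia :=
  D.vanishing (A := Shape.boundaryV Dia) (B := Shape.V Dia) VShape.boundary.ι

end Prederivator

/-! The argument works for any functor `i : A ⥤ B` in place of `∂V ⊂ V`, and rests on one fact: in
`D(B × -)`, Kan extensions along `id_B × u` are computed separately at each object `b` of `B`.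
Indeed the slice `(B × J)_{/(b,k)}` contains `J_{/k}` as a reflective subcategory. The inclusion is
a right adjoint, hence final, so by (Der4) both slices compute the same colimit; dually for `(B ×
J)_{(b,k)/}`. These are `leftExact_sectCell` and `rightExact_sectCell'`.

There are two consequences. Kan extensions preserve zero objects in a pointed derivator, so `(id_B ×
u)_!` and `(id_B × u)_*` preserve vanishing on `A` and restrict to the full subcategories; this is
(Der3). Moreover the values at the objects `b` are strict morphisms from the vanishing prederivator
to `D` that preserve both kinds of Kan extension, and by (Der2) for `D` they are jointly
conservative.

(Der2), (Der4) and regularity each say that a canonical morphism built from Kan extensions is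
invertible, or that invertibility is detected somewhere. Such statements pass from `D` to the source
of a jointly conservative family that preserves Kan extensions: `JointlyConservative.isDerivator`
and `JointlyConservative.isRegular`. Only (Der1) needs a separate argument, by distributing `B × -`
over disjoint unions.

Kan extensions are handled as universal arrows rather than as chosen adjoints. A mate is invertible
exactly when its square carries universal arrows to universal arrows, a condition that pastes and
transports without any choices. -/

/-! ### Universal arrows -/

section Universal

variable {C : Type*} [Category C] {E : Type*} [Category E]

/-- `f : X ⟶ R Y` is a universal arrow from `X` to `R`. -/
def IsUniversal (R : C ⥤ E) {X : E} {Y : C} (f : X ⟶ R.obj Y) : Prop :=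
  ∀ ⦃Z : C⦄ (g : X ⟶ R.obj Z), ∃! h : Y ⟶ Z, f ≫ R.map h = g

/-- `f : R Y ⟶ X` is a universal arrow from `R` to `X`. -/
def IsCouniversal (R : C ⥤ E) {X : E} {Y : C} (f : R.obj Y ⟶ X) : Prop :=
  ∀ ⦃Z : C⦄ (g : R.obj Z ⟶ X), ∃! h : Z ⟶ Y, R.map h ≫ f = g

namespace IsUniversal

variable {R : C ⥤ E} {X : E} {Y : C} {f : X ⟶ R.obj Y}

theorem hom_ext (hf : IsUniversal R f) {Z : C} {h h' : Y ⟶ Z}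
    (e : f ≫ R.map h = f ≫ R.map h') : h = h' :=
  (hf (f ≫ R.map h')).unique e rfl

theorem iso_comp (hf : IsUniversal R f) {X' : E} (e : X' ⟶ X) [IsIso e] :
    IsUniversal R (e ≫ f) := by
  intro Z g
  obtain ⟨h, h₁, h₂⟩ := hf (inv e ≫ g)
  refine ⟨h, by simp [h₁], fun h' e' => h₂ h' ?_⟩
  simp [← e']

theorem comp_iso (hf : IsUniversal R f) {Y' : C} (e : Y ⟶ Y') [IsIso e] :
    IsUniversal R (f ≫ R.map e) := by
  intro Z g
  obtain ⟨h, h₁, h₂⟩ := hf g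
  refine ⟨inv e ≫ h, by simp [h₁], fun h' e' => ?_⟩
  rw [← h₂ (e ≫ h') (by simpa using e')]
  simp

theorem isIso (hf : IsUniversal R f) {Y' : C} {f' : X ⟶ R.obj Y'} (hf' : IsUniversal R f')
    {h : Y ⟶ Y'} (e : f ≫ R.map h = f') : IsIso h := by
  obtain ⟨k, hk, -⟩ := hf' f
  refine ⟨k, hf.hom_ext ?_, hf'.hom_ext ?_⟩
  · rw [R.map_comp, ← Category.assoc, e, hk]
    simp
  · rw [R.map_comp, ← Category.assoc, hk, e]
    simp

theorem exists_iso (hf : IsUniversal R f) {Y' : C} {f' : X ⟶ R.obj Y'}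
    (hf' : IsUniversal R f') : ∃ h : Y ⟶ Y', IsIso h ∧ f ≫ R.map h = f' := by
  obtain ⟨h, e, -⟩ := hf f'
  exact ⟨h, hf.isIso hf' e, e⟩

theorem of_adjunction {L : E ⥤ C} (adj : L ⊣ R) (X : E) : IsUniversal R (adj.unit.app X) := by
  intro Z g
  refine ⟨(adj.homEquiv X Z).symm g, ?_, fun h e => ?_⟩
  · exact (adj.homEquiv_unit ..).symm.trans ((adj.homEquiv X Z).apply_symm_apply g)
  · exact (Equiv.eq_symm_apply _).mpr ((adj.homEquiv_unit ..).trans e)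

end IsUniversal

namespace IsCouniversal

variable {R : C ⥤ E} {X : E} {Y : C} {f : R.obj Y ⟶ X}

theorem hom_ext (hf : IsCouniversal R f) {Z : C} {h h' : Z ⟶ Y}
    (e : R.map h ≫ f = R.map h' ≫ f) : h = h' :=
  (hf (R.map h' ≫ f)).unique e rfl

theorem comp_iso (hf : IsCouniversal R f) {X' : E} (e : X ⟶ X') [IsIso e] :
    IsCouniversal R (f ≫ e) := by
  intro Z g
  obtain ⟨h, h₁, h₂⟩ := hf (g ≫ inv e)
  refine ⟨h, by simp [reassoc_of% h₁], fun h' e' => h₂ h' ?_⟩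
  simp [← e']

theorem iso_comp (hf : IsCouniversal R f) {Y' : C} (e : Y' ⟶ Y) [IsIso e] :
    IsCouniversal R (R.map e ≫ f) := by
  intro Z g
  obtain ⟨h, h₁, h₂⟩ := hf g
  refine ⟨h ≫ inv e, by simp [h₁], fun h' e' => ?_⟩
  rw [← h₂ (h' ≫ e) (by simpa using e')]
  simp

theorem isIso (hf : IsCouniversal R f) {Y' : C} {f' : R.obj Y' ⟶ X} (hf' : IsCouniversal R f')
    {h : Y' ⟶ Y} (e : R.map h ≫ f = f') : IsIso h := by
  obtain ⟨k, hk, -⟩ := hf' f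
  refine ⟨k, hf'.hom_ext ?_, hf.hom_ext ?_⟩
  · rw [R.map_comp, Category.assoc, hk, e]
    simp
  · rw [R.map_comp, Category.assoc, e, hk]
    simp

theorem exists_iso (hf : IsCouniversal R f) {Y' : C} {f' : R.obj Y' ⟶ X}
    (hf' : IsCouniversal R f') : ∃ h : Y' ⟶ Y, IsIso h ∧ R.map h ≫ f = f' := by
  obtain ⟨h, e, -⟩ := hf f'
  exact ⟨h, hf.isIso hf' e, e⟩

theorem of_adjunction {L : E ⥤ C} (adj : R ⊣ L) (X : E) : IsCouniversal R (adj.counit.app X) := by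
  intro Z g
  refine ⟨adj.homEquiv Z X g, ?_, fun h e => ?_⟩
  · exact (adj.homEquiv_counit ..).symm.trans ((adj.homEquiv Z X).symm_apply_apply g)
  · exact (Equiv.symm_apply_eq _).mp ((adj.homEquiv_counit ..).trans e)

end IsCouniversal

theorem isRightAdjoint_of_isUniversal {R : C ⥤ E}
    (H : ∀ X : E, ∃ (Y : C) (f : X ⟶ R.obj Y), IsUniversal R f) : R.IsRightAdjoint := by
  rw [isRightAdjoint_iff_hasInitial_structuredArrow]
  intro X
  obtain ⟨Y, f, hf⟩ := H X
  have : ∀ A : StructuredArrow X R, Nonempty (Unique (StructuredArrow.mk f ⟶ A)) := fun A => by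
    obtain ⟨h, e, he⟩ := hf A.hom
    exact ⟨⟨⟨StructuredArrow.homMk h e⟩, fun k => StructuredArrow.hom_ext _ _
      (he _ (StructuredArrow.w k))⟩⟩
  have := fun A => (this A).some
  exact hasInitial_of_unique (StructuredArrow.mk f)

theorem isLeftAdjoint_of_isCouniversal {R : C ⥤ E}
    (H : ∀ X : E, ∃ (Y : C) (f : R.obj Y ⟶ X), IsCouniversal R f) : R.IsLeftAdjoint := by
  rw [isLeftAdjoint_iff_hasTerminal_costructuredArrow]
  intro X
  obtain ⟨Y, f, hf⟩ := H X
  have : ∀ A : CostructuredArrow R X, Nonempty (Unique (A ⟶ CostructuredArrow.mk f)) := fun A => by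
    obtain ⟨h, e, he⟩ := hf A.hom
    exact ⟨⟨⟨CostructuredArrow.homMk h e⟩, fun k => CostructuredArrow.hom_ext _ _
      (he _ (CostructuredArrow.w k))⟩⟩
  have := fun A => (this A).some
  exact hasTerminal_of_unique (CostructuredArrow.mk f)

/-- Strict functoriality of restriction is a propositional equality of functors, so coherence
identities carry transports on both sides. This moves them all to one side. -/
theorem eq_eqToHom_conj {W X X' Y Y' Z : C} {f : X ⟶ Y} {g : X' ⟶ Y'} {p : W = X} {q : Y = Z}
    {p' : W = X'} {q' : Y' = Z}
    (h : eqToHom p ≫ f ≫ eqToHom q = eqToHom p' ≫ g ≫ eqToHom q') :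
    f = eqToHom (p.symm.trans p') ≫ g ≫ eqToHom (q'.trans q.symm) := by
  subst p q p' q'
  simpa using h

theorem isIso_map_iff_of_eq {F G : C ⥤ E} (h : F = G) {X Y : C} (f : X ⟶ Y) :
    IsIso (F.map f) ↔ IsIso (G.map f) := by
  subst h
  rfl

end Universal

/-! ### Exact squares and invertible mates -/

namespace Prederivator

variable {Dia : DiagramDomain.{u}} (D : Prederivator.{u, v, w} Dia)

theorem pull_obj_comp {I J K : Dia.Shape} (F : I ⥤ J) (G : J ⥤ K) (X : D.obj K) :
    (D.pull (F ⋙ G)).obj X = (D.pull F).obj ((D.pull G).obj X) :=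
  Functor.congr_obj (D.pull_comp F G) X

theorem pull_map_comp {I J K : Dia.Shape} (F : I ⥤ J) (G : J ⥤ K) {X Y : D.obj K} (f : X ⟶ Y) :
    (D.pull (F ⋙ G)).map f = eqToHom (D.pull_obj_comp F G X) ≫
      (D.pull F).map ((D.pull G).map f) ≫ eqToHom (D.pull_obj_comp F G Y).symm :=
  Functor.congr_hom (D.pull_comp F G) f

theorem pullMap_eqToHom {J K : Dia.Shape} {F G : J ⥤ K} (h : F = G) :
    D.pullMap (eqToHom h) = eqToHom (congrArg D.pull h) := by
  subst h
  exact D.pullMap_id F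

section Squares

variable {I J J' K : Dia.Shape} {F : I ⥤ J} {G : J ⥤ K} {F' : I ⥤ J'} {G' : J' ⥤ K}

theorem square_app (α : F ⋙ G ⟶ F' ⋙ G') (Y : D.obj K) :
    (D.square α).app Y = eqToHom (D.pull_obj_comp F G Y).symm ≫ (D.pullMap α).app Y ≫
      eqToHom (D.pull_obj_comp F' G' Y) := by
  simp [square, eqToHom_app]

theorem square_app_of_eq_eqToHom (h : F ⋙ G = F' ⋙ G') {α : F ⋙ G ⟶ F' ⋙ G'}
    (hα : α = eqToHom h) (Y : D.obj K) :
    (D.square α).app Y = eqToHom (((D.pull_obj_comp F G Y).symm.trans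
      (congrArg (fun H => (D.pull H).obj Y) h)).trans (D.pull_obj_comp F' G' Y)) := by
  subst hα
  rw [square_app, pullMap_eqToHom]
  simp [eqToHom_app]

theorem square_naturality (α : F ⋙ G ⟶ F' ⋙ G') {Y Z : D.obj K} (f : Y ⟶ Z) :
    (D.pull F).map ((D.pull G).map f) ≫ (D.square α).app Z =
      (D.square α).app Y ≫ (D.pull F').map ((D.pull G').map f) :=
  (D.square α).naturality f

/-- The square `α` sends universal arrows to `G^*` to universal arrows to `F'^*`. -/
def LeftExact (α : F ⋙ G ⟶ F' ⋙ G') : Prop :=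
  ∀ ⦃X : D.obj J⦄ ⦃Y : D.obj K⦄ (f : X ⟶ (D.pull G).obj Y), IsUniversal (D.pull G) f →
    IsUniversal (D.pull F') (Y := (D.pull G').obj Y) ((D.pull F).map f ≫ (D.square α).app Y)

/-- The square `α` sends universal arrows from `G'^*` to universal arrows from `F^*`. -/
def RightExact (α : F ⋙ G ⟶ F' ⋙ G') : Prop :=
  ∀ ⦃X : D.obj J'⦄ ⦃Y : D.obj K⦄ (f : (D.pull G').obj Y ⟶ X), IsCouniversal (D.pull G') f →
    IsCouniversal (D.pull F) (Y := (D.pull G).obj Y) ((D.square α).app Y ≫ (D.pull F').map f)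

variable {D}

/-- Universal arrows from a fixed `X` differ by an isomorphism of their targets, and the square is
natural, so one test arrow for each `X` suffices. -/
theorem LeftExact.of_exists (α : F ⋙ G ⟶ F' ⋙ G')
    (H : ∀ X : D.obj J, ∃ (Y : D.obj K) (f : X ⟶ (D.pull G).obj Y), IsUniversal (D.pull G) f ∧
      IsUniversal (D.pull F') (Y := (D.pull G').obj Y) ((D.pull F).map f ≫ (D.square α).app Y)) :
    D.LeftExact α := by
  intro X Y f hf
  obtain ⟨Y', f', hf', h⟩ := H X
  obtain ⟨k, hk, rfl⟩ := hf'.exists_iso hf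
  convert h.comp_iso ((D.pull G').map k) using 1
  rw [Functor.map_comp, Category.assoc, Category.assoc, square_naturality]

theorem RightExact.of_exists (α : F ⋙ G ⟶ F' ⋙ G')
    (H : ∀ X : D.obj J', ∃ (Y : D.obj K) (f : (D.pull G').obj Y ⟶ X), IsCouniversal (D.pull G') f ∧
      IsCouniversal (D.pull F) (Y := (D.pull G).obj Y) ((D.square α).app Y ≫ (D.pull F').map f)) :
    D.RightExact α := by
  intro X Y f hf
  obtain ⟨Y', f', hf', h⟩ := H X
  obtain ⟨k, hk, rfl⟩ := hf'.exists_iso hf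
  convert h.iso_comp ((D.pull G).map k) using 1
  rw [Functor.map_comp, ← Category.assoc, ← Category.assoc, square_naturality]

theorem unit_leftMate [D.HasKanExtensions] (α : F ⋙ G ⟶ F' ⋙ G') (X : D.obj J) :
    (D.lanAdj F').unit.app ((D.pull F).obj X) ≫ (D.pull F').map ((D.leftMate α).app X) =
      (D.pull F).map ((D.lanAdj G).unit.app X) ≫ (D.square α).app ((D.lan G).obj X) :=
  (unit_mateEquiv_symm (D.lanAdj G) (D.lanAdj F') (TwoSquare.mk _ _ _ _ (D.square α)) X).symm

theorem rightMate_counit [D.HasKanExtensions] (α : F ⋙ G ⟶ F' ⋙ G') (X : D.obj J') :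
    (D.pull F).map ((D.rightMate α).app X) ≫ (D.ranAdj F).counit.app ((D.pull F').obj X) =
      (D.square α).app ((D.ran G').obj X) ≫ (D.pull F').map ((D.ranAdj G').counit.app X) :=
  mateEquiv_counit (D.ranAdj G') (D.ranAdj F) (TwoSquare.mk _ _ _ _ (D.square α)) X

/-- By `unit_leftMate` the mate is the comparison from the unit of `F'_!` to the arrow that the
square makes of the unit of `G_!`. It is invertible exactly when the latter arrow is universal as
well. -/
theorem isIso_leftMate_iff [D.HasKanExtensions] (α : F ⋙ G ⟶ F' ⋙ G') :
    IsIso (D.leftMate α) ↔ D.LeftExact α := by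
  constructor
  · intro h
    refine .of_exists α fun X => ⟨_, _, .of_adjunction (D.lanAdj G) X, ?_⟩
    rw [← unit_leftMate]
    exact (IsUniversal.of_adjunction (D.lanAdj F') _).comp_iso _
  · intro h
    rw [NatTrans.isIso_iff_isIso_app]
    intro X
    exact (IsUniversal.of_adjunction (D.lanAdj F') _).isIso
      (h _ (.of_adjunction (D.lanAdj G) X)) (unit_leftMate α X)

theorem isIso_rightMate_iff [D.HasKanExtensions] (α : F ⋙ G ⟶ F' ⋙ G') :
    IsIso (D.rightMate α) ↔ D.RightExact α := by
  constructor
  · intro h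
    refine .of_exists α fun X => ⟨_, _, .of_adjunction (D.ranAdj G') X, ?_⟩
    rw [← rightMate_counit]
    exact (IsCouniversal.of_adjunction (D.ranAdj F) _).iso_comp _
  · intro h
    rw [NatTrans.isIso_iff_isIso_app]
    intro X
    exact (IsCouniversal.of_adjunction (D.ranAdj F) _).isIso
      (h _ (.of_adjunction (D.ranAdj G') X)) (rightMate_counit α X)

/-! ### Pasting -/

variable {I₂ J₂ : Dia.Shape} {H : I₂ ⥤ I} {F₂ : I₂ ⥤ J₂} {H' : J₂ ⥤ J'}

/-- The horizontal paste of two squares. -/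
abbrev pasteCell (β : H ⋙ F' ⟶ F₂ ⋙ H') (α : F ⋙ G ⟶ F' ⋙ G') :
    (H ⋙ F) ⋙ G ⟶ F₂ ⋙ H' ⋙ G' :=
  Functor.whiskerLeft H α ≫ Functor.whiskerRight β G'

variable (D) in
theorem square_pasteCell_app (β : H ⋙ F' ⟶ F₂ ⋙ H') (α : F ⋙ G ⟶ F' ⋙ G') (Y : D.obj K) :
    (D.square (pasteCell β α)).app Y =
      eqToHom (D.pull_obj_comp H F _) ≫ (D.pull H).map ((D.square α).app Y) ≫
        (D.square β).app ((D.pull G').obj Y) ≫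
          eqToHom (congrArg (D.pull F₂).obj (D.pull_obj_comp H' G' Y).symm) := by
  have h₁ := NatTrans.congr_app (D.pullMap_whiskerLeft H α) Y
  have h₂ := NatTrans.congr_app (D.pullMap_whiskerRight β G') Y
  have h₃ := NatTrans.congr_app (D.pullMap_comp (Functor.whiskerLeft H α)
    (Functor.whiskerRight β G')) Y
  simp only [NatTrans.comp_app, eqToHom_app, Functor.whiskerRight_app,
    Functor.whiskerLeft_app] at h₁ h₂ h₃
  simp only [square_app, Functor.map_comp, eqToHom_map, Category.assoc]
  erw [h₃, h₁, h₂]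
  simp [eqToHom_trans_assoc, eqToHom_trans]

/-- The arrow that a pasted square makes of `f`. -/
theorem map_comp_square_pasteCell_app (β : H ⋙ F' ⟶ F₂ ⋙ H') (α : F ⋙ G ⟶ F' ⋙ G')
    {X : D.obj J} {Y : D.obj K} (f : X ⟶ (D.pull G).obj Y) :
    (D.pull (H ⋙ F)).map f ≫ (D.square (pasteCell β α)).app Y =
      eqToHom (D.pull_obj_comp H F X) ≫
        ((D.pull H).map ((D.pull F).map f ≫ (D.square α).app Y) ≫
          (D.square β).app ((D.pull G').obj Y)) ≫
          (D.pull F₂).map (eqToHom (D.pull_obj_comp H' G' Y).symm) := by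
  rw [square_pasteCell_app, pull_map_comp]
  simp [eqToHom_map]

theorem LeftExact.paste {β : H ⋙ F' ⟶ F₂ ⋙ H'} {α : F ⋙ G ⟶ F' ⋙ G'} (hβ : D.LeftExact β)
    (hα : D.LeftExact α) : D.LeftExact (pasteCell β α) := by
  intro X Y f hf
  rw [map_comp_square_pasteCell_app]
  exact ((hβ _ (hα f hf)).comp_iso _).iso_comp _

end Squares

end Prederivator

/-! ### Transposing universal arrows across an adjunction -/

theorem IsUniversal.homEquiv_symm {C E E' : Type*} [Category C] [Category E] [Category E']
    {R : C ⥤ E} {R' : E ⥤ E'} {L : E' ⥤ E} (adj : L ⊣ R') {X : E'} {Y : C}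
    {f : X ⟶ (R ⋙ R').obj Y} (hf : IsUniversal (R ⋙ R') f) :
    IsUniversal R ((adj.homEquiv X (R.obj Y)).symm f) := by
  intro Z g
  obtain ⟨h, h₁, h₂⟩ := hf (adj.homEquiv _ _ g)
  refine ⟨h, ?_, fun h' e => h₂ h' ?_⟩
  · change _ = g
    rw [← adj.homEquiv_naturality_right_symm, Equiv.symm_apply_eq]
    exact h₁
  · change _ = g at e
    rw [← adj.homEquiv_naturality_right_symm, Equiv.symm_apply_eq] at e
    exact e

theorem IsCouniversal.homEquiv {C E E' : Type*} [Category C] [Category E] [Category E']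
    {R : C ⥤ E} {R' : E ⥤ E'} {L : E' ⥤ E} (adj : R' ⊣ L) {X : E'} {Y : C}
    {f : (R ⋙ R').obj Y ⟶ X} (hf : IsCouniversal (R ⋙ R') f) :
    IsCouniversal R (adj.homEquiv (R.obj Y) X f) := by
  intro Z g
  obtain ⟨h, h₁, h₂⟩ := hf ((adj.homEquiv _ _).symm g)
  refine ⟨h, ?_, fun h' e => h₂ h' ?_⟩
  · change _ = g
    rw [← adj.homEquiv_naturality_left, ← Equiv.eq_symm_apply]
    exact h₁
  · change _ = g at e
    rw [← adj.homEquiv_naturality_left, ← Equiv.eq_symm_apply] at e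
    exact e

theorem IsUniversal.of_eq {C E : Type*} [Category C] [Category E] {R R' : C ⥤ E} (h : R = R')
    {X : E} {Y : C} {f : X ⟶ R.obj Y} (hf : IsUniversal R f) :
    IsUniversal R' (f ≫ eqToHom (Functor.congr_obj h Y)) := by
  subst h
  simpa using hf

theorem IsCouniversal.of_eq {C E : Type*} [Category C] [Category E] {R R' : C ⥤ E} (h : R = R')
    {X : E} {Y : C} {f : R.obj Y ⟶ X} (hf : IsCouniversal R f) :
    IsCouniversal R' (eqToHom (Functor.congr_obj h Y).symm ≫ f) := by
  subst h
  simpa using hf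

/-! ### Vertical pasting and pointwise tests of exactness -/

namespace Prederivator

variable {Dia : DiagramDomain.{u}} {D : Prederivator.{u, v, w} Dia}

section Squares

variable {I J J' K : Dia.Shape} {F : I ⥤ J} {G : J ⥤ K} {F' : I ⥤ J'} {G' : J' ⥤ K}
  {I₂ J₂ : Dia.Shape} {H : J₂ ⥤ J} {F₂ : I₂ ⥤ J₂} {H' : I₂ ⥤ I}

/-- The vertical paste of two squares. -/
abbrev pasteCell' (β : F₂ ⋙ H ⟶ H' ⋙ F) (α : F ⋙ G ⟶ F' ⋙ G') :
    F₂ ⋙ H ⋙ G ⟶ (H' ⋙ F') ⋙ G' :=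
  Functor.whiskerRight β G ≫ Functor.whiskerLeft H' α

theorem square_pasteCell'_app (β : F₂ ⋙ H ⟶ H' ⋙ F) (α : F ⋙ G ⟶ F' ⋙ G') (Y : D.obj K) :
    (D.square (pasteCell' β α)).app Y =
      (D.pull F₂).map (eqToHom (D.pull_obj_comp H G Y)) ≫
        (D.square β).app ((D.pull G).obj Y) ≫ (D.pull H').map ((D.square α).app Y) ≫
          eqToHom (D.pull_obj_comp H' F' _).symm := by
  have h₁ := NatTrans.congr_app (D.pullMap_whiskerLeft H' α) Y
  have h₂ := NatTrans.congr_app (D.pullMap_whiskerRight β G) Y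
  have h₃ := NatTrans.congr_app (D.pullMap_comp (Functor.whiskerRight β G)
    (Functor.whiskerLeft H' α)) Y
  simp only [NatTrans.comp_app, eqToHom_app, Functor.whiskerRight_app,
    Functor.whiskerLeft_app] at h₁ h₂ h₃
  simp only [square_app, Functor.map_comp, eqToHom_map, Category.assoc]
  erw [h₃, h₁, h₂]
  simp [eqToHom_trans_assoc, eqToHom_trans]

theorem square_pasteCell'_app_comp_map (β : F₂ ⋙ H ⟶ H' ⋙ F) (α : F ⋙ G ⟶ F' ⋙ G')
    {X : D.obj J'} {Y : D.obj K} (f : (D.pull G').obj Y ⟶ X) :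
    (D.square (pasteCell' β α)).app Y ≫ (D.pull (H' ⋙ F')).map f =
      (D.pull F₂).map (eqToHom (D.pull_obj_comp H G Y)) ≫
        ((D.square β).app ((D.pull G).obj Y) ≫
          (D.pull H').map ((D.square α).app Y ≫ (D.pull F').map f)) ≫
          eqToHom (D.pull_obj_comp H' F' X).symm := by
  rw [square_pasteCell'_app, pull_map_comp]
  simp [eqToHom_map]

theorem RightExact.paste {β : F₂ ⋙ H ⟶ H' ⋙ F} {α : F ⋙ G ⟶ F' ⋙ G'} (hβ : D.RightExact β)
    (hα : D.RightExact α) : D.RightExact (pasteCell' β α) := by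
  intro X Y f hf
  rw [square_pasteCell'_app_comp_map]
  exact ((hβ _ (hα f hf)).comp_iso _).iso_comp _

theorem leftExact_overCell [D.IsDerivator] (F : J ⥤ K) (k : K) :
    D.LeftExact (F := Shape.prOver F k) (G := F) (F' := Shape.proj (Shape.sliceOver F k))
      (G' := Shape.point k) (overCell F k) :=
  (isIso_leftMate_iff _).mp (IsDerivator.der4_left F k)

theorem rightExact_underCell [D.IsDerivator] (F : J ⥤ K) (k : K) :
    D.RightExact (F := Shape.proj (Shape.sliceUnder F k)) (G := Shape.point k)
      (F' := Shape.prUnder F k) (G' := F) (underCell F k) :=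
  (isIso_rightMate_iff _).mp (IsDerivator.der4_right F k)

/-- By (Der2) the comparison with `F'_!` may be tested at each `k`. There `β k` and its paste with
`α` give two universal arrows out of the same object, and the value of the comparison at `k` relates
them. Allowing squares other than the slices gives `leftExact_baseCell` directly from the fibers. -/
theorem LeftExact.of_squares [D.IsDerivator] (α : F ⋙ G ⟶ F' ⋙ G') {S : J' → Dia.Shape}
    {p : ∀ k, S k ⥤ I} (β : ∀ k, p k ⋙ F' ⟶ Shape.proj (S k) ⋙ Shape.point k)
    (hβ : ∀ k, D.LeftExact (β k)) (hα : ∀ k, D.LeftExact (pasteCell (β k) α)) :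
    D.LeftExact α := by
  intro X Y f hf
  obtain ⟨h, hh, -⟩ := IsUniversal.of_adjunction (D.lanAdj F') ((D.pull F).obj X)
    ((D.pull F).map f ≫ (D.square α).app Y)
  have : IsIso h := by
    rw [IsDerivator.der2]
    intro k
    have h₁ := hβ k _ (IsUniversal.of_adjunction (D.lanAdj F') ((D.pull F).obj X))
    have h₂ := hα k f hf
    rw [map_comp_square_pasteCell_app] at h₂
    refine h₁.isIso (h₂.iso_comp (eqToHom (D.pull_obj_comp _ _ _).symm) |>.comp_iso
      (eqToHom (D.pull_obj_comp _ _ _))) ?_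
    rw [← hh, Category.assoc, ← square_naturality]
    simp [eqToHom_map]
  rw [← hh]
  exact (IsUniversal.of_adjunction (D.lanAdj F') _).comp_iso h

theorem LeftExact.of_pointwise [D.IsDerivator] (α : F ⋙ G ⟶ F' ⋙ G')
    (H : ∀ k : J', D.LeftExact (pasteCell (F₂ := Shape.proj (Shape.sliceOver F' k))
      (H' := Shape.point k) (overCell F' k) α)) : D.LeftExact α :=
  .of_squares α (overCell F') (leftExact_overCell F') H

theorem RightExact.of_pointwise [D.IsDerivator] (α : F ⋙ G ⟶ F' ⋙ G')
    (H : ∀ k : J, D.RightExact (pasteCell' (F₂ := Shape.proj (Shape.sliceUnder F k))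
      (H := Shape.point k) (underCell F k) α)) : D.RightExact α := by
  intro X Y f hf
  obtain ⟨h, hh, -⟩ := IsCouniversal.of_adjunction (D.ranAdj F) ((D.pull F').obj X)
    ((D.square α).app Y ≫ (D.pull F').map f)
  have : IsIso h := by
    rw [IsDerivator.der2]
    intro k
    have h₁ := rightExact_underCell F k _
      (IsCouniversal.of_adjunction (D.ranAdj F) ((D.pull F').obj X))
    have h₂ := H k f hf
    rw [square_pasteCell'_app_comp_map] at h₂
    refine h₁.isIso (h₂.comp_iso (eqToHom (D.pull_obj_comp _ _ _)) |>.iso_comp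
      (eqToHom (D.pull_obj_comp _ _ _).symm)) ?_
    rw [← hh, Functor.map_comp, ← Category.assoc, square_naturality]
    simp [eqToHom_map]
  rw [← hh]
  exact (IsCouniversal.of_adjunction (D.ranAdj F) _).iso_comp h

end Squares

/-! ### Finality of adjoint functors -/

section Adjunction

variable {A L : Dia.Shape} {l : L ⥤ A} {r : A ⥤ L}

variable (D) in
/-- Restriction sends an adjunction `l ⊣ r` to an adjunction `r^* ⊣ l^*`. -/
def pullAdj (adj : l ⊣ r) : D.pull r ⊣ D.pull l where
  unit := eqToHom (D.pull_id L).symm ≫ D.pullMap adj.unit ≫ eqToHom (D.pull_comp l r)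
  counit := eqToHom (D.pull_comp r l).symm ≫ D.pullMap adj.counit ≫ eqToHom (D.pull_id A)
  left_triangle_components X := by
    have h₁ := NatTrans.congr_app (D.pullMap_whiskerLeft r adj.unit) X
    have h₂ := NatTrans.congr_app (D.pullMap_whiskerRight adj.counit r) X
    have h₃ := NatTrans.congr_app (D.pullMap_comp (Functor.whiskerLeft r adj.unit)
      (Functor.whiskerRight adj.counit r)) X
    have h₄ : Functor.whiskerLeft r adj.unit ≫ Functor.whiskerRight adj.counit r = 𝟙 r := by
      ext x
      simp
    have h₅ := NatTrans.congr_app ((congrArg D.pullMap h₄).trans (D.pullMap_id r)) X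
    have h₆ := h₃.symm.trans h₅
    simp only [NatTrans.comp_app, eqToHom_app, Functor.whiskerRight_app,
      Functor.whiskerLeft_app] at h₁ h₂ h₆
    rw [h₁, h₂] at h₆
    simp only [NatTrans.comp_app, eqToHom_app, Functor.map_comp, eqToHom_map, Category.assoc]
    simp only [Category.assoc, eqToHom_trans_assoc] at h₆ ⊢
    exact h₆
  right_triangle_components X := by
    have h₁ := NatTrans.congr_app (D.pullMap_whiskerLeft l adj.counit) X
    have h₂ := NatTrans.congr_app (D.pullMap_whiskerRight adj.unit l) X
    have h₃ := NatTrans.congr_app (D.pullMap_comp (Functor.whiskerRight adj.unit l)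
      (Functor.whiskerLeft l adj.counit)) X
    have h₄ : Functor.whiskerRight adj.unit l ≫ Functor.whiskerLeft l adj.counit = 𝟙 l := by
      ext x
      simp
    have h₅ := NatTrans.congr_app ((congrArg D.pullMap h₄).trans (D.pullMap_id l)) X
    have h₆ := h₃.symm.trans h₅
    simp only [NatTrans.comp_app, eqToHom_app, Functor.whiskerRight_app,
      Functor.whiskerLeft_app] at h₁ h₂ h₆
    rw [h₁, h₂] at h₆
    simp only [NatTrans.comp_app, eqToHom_app, Functor.map_comp, eqToHom_map, Category.assoc]
    simp only [Category.assoc, eqToHom_trans_assoc] at h₆ ⊢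
    exact h₆

/-- A 2-cell that becomes an identity over `M` acts as an identity on diagrams restricted from `M`.
Over the final category this applies to every 2-cell, in particular to the unit and the counit of an
adjunction. -/
theorem pullMap_app_pull_of_whiskerRight {J K M : Dia.Shape} {F G : J ⥤ K} (τ : F ⟶ G)
    (P : K ⥤ M) (h : F ⋙ P = G ⋙ P) (hτ : Functor.whiskerRight τ P = eqToHom h) (Y : D.obj M) :
    (D.pullMap τ).app ((D.pull P).obj Y) =
      eqToHom (((D.pull_obj_comp F P Y).symm.trans
        (congrArg (fun H => (D.pull H).obj Y) h)).trans (D.pull_obj_comp G P Y)) := by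
  have h₁ := NatTrans.congr_app (D.pullMap_whiskerRight τ P) Y
  rw [hτ, pullMap_eqToHom] at h₁
  simp only [NatTrans.comp_app, eqToHom_app, Functor.whiskerLeft_app] at h₁
  have h₂ := eq_eqToHom_conj (h₁.symm.trans
    (show _ = eqToHom rfl ≫ 𝟙 ((D.pull (F ⋙ P)).obj Y) ≫
      eqToHom (congrArg (fun H => (D.pull H).obj Y) h) by simp))
  simpa using h₂

theorem pull_proj_eq_comp (F : A ⥤ L) :
    D.pull (Shape.proj A) = D.pull (Shape.proj L) ⋙ D.pull F :=
  D.pull_comp F (Shape.proj L)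

theorem pull_pull_proj (F : L ⥤ A) (G : A ⥤ L) (Y : D.obj (Shape.final Dia)) :
    (D.pull G).obj ((D.pull F).obj ((D.pull (Shape.proj A)).obj Y)) =
      (D.pull (Shape.proj A)).obj Y :=
  ((Functor.congr_obj (pull_proj_eq_comp G) Y).trans
    (congrArg (D.pull G).obj (Functor.congr_obj (pull_proj_eq_comp F) Y))).symm

variable (D) in
theorem pullAdj_counit_app_pull (adj : l ⊣ r) (Y : D.obj (Shape.final Dia)) :
    (D.pullAdj adj).counit.app ((D.pull (Shape.proj A)).obj Y) =
      eqToHom (pull_pull_proj l r Y) := by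
  have h := D.pullMap_app_pull_of_whiskerRight adj.counit (Shape.proj A) rfl
    (Subsingleton.elim _ _) Y
  simp only [pullAdj, NatTrans.comp_app, eqToHom_app, h, eqToHom_trans]

variable (D) in
theorem pullAdj_unit_app_pull (adj : l ⊣ r) (Y : D.obj (Shape.final Dia)) :
    (D.pullAdj adj).unit.app ((D.pull (Shape.proj L)).obj Y) =
      eqToHom (pull_pull_proj r l Y).symm := by
  have h := D.pullMap_app_pull_of_whiskerRight adj.unit (Shape.proj L) rfl
    (Subsingleton.elim _ _) Y
  simp only [pullAdj, NatTrans.comp_app, eqToHom_app, h, eqToHom_trans]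

/-- The square of a functor over the final category. -/
def finalCell (r : A ⥤ L) :
    r ⋙ Shape.proj L ⟶ Shape.proj A ⋙ 𝟭 (Shape.final Dia) :=
  eqToHom rfl

/-- The transposed square of a functor over the final category. -/
def finalCell' (l : L ⥤ A) :
    Shape.proj L ⋙ 𝟭 (Shape.final Dia) ⟶ l ⋙ Shape.proj A :=
  eqToHom rfl

/-- Right adjoints are final. -/
theorem leftExact_finalCell (adj : l ⊣ r) : D.LeftExact (F := r) (G := Shape.proj L)
    (F' := Shape.proj A) (G' := 𝟭 (Shape.final Dia)) (finalCell r) := by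
  intro X Y f hf
  -- As `π_L^* = l^* π_A^*`, the arrow `f` transposes across `r^* ⊣ l^*` to a universal arrow to
  -- `π_A^*`. The counit is an identity on constant diagrams, so the transpose is the arrow made by
  -- the square.
  have h₁ := (hf.of_eq (pull_proj_eq_comp l)).homEquiv_symm (D.pullAdj adj)
  have h₂ := D.square_app_of_eq_eqToHom (F := r) (G := Shape.proj L)
    (F' := Shape.proj A) (G' := 𝟭 (Shape.final Dia)) (α := finalCell r) rfl rfl Y
  convert h₁.comp_iso (eqToHom (Functor.congr_obj (D.pull_id _) Y).symm) using 1
  rw [Adjunction.homEquiv_counit, pullAdj_counit_app_pull, h₂]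
  simp [eqToHom_map]

/-- Left adjoints are initial. -/
theorem rightExact_finalCell' (adj : l ⊣ r) : D.RightExact (F := Shape.proj L) (G := 𝟭 (Shape.final Dia))
    (F' := l) (G' := Shape.proj A) (finalCell' l) := by
  intro X Y f hf
  have h₁ := (hf.of_eq (pull_proj_eq_comp r)).homEquiv (D.pullAdj adj)
  have h₂ := D.square_app_of_eq_eqToHom (F := Shape.proj L) (G := 𝟭 (Shape.final Dia))
    (F' := l) (G' := Shape.proj A) (α := finalCell' l) rfl rfl Y
  convert h₁.iso_comp (eqToHom (Functor.congr_obj (D.pull_id _) Y)) using 1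
  rw [Adjunction.homEquiv_unit, pullAdj_unit_app_pull, h₂]
  simp [eqToHom_map]

end Adjunction

end Prederivator

namespace Prederivator

variable {Dia : DiagramDomain.{u}} {D : Prederivator.{u, v, w} Dia}

/-! ### Kan extensions along `id_B × F` at an object of `B` -/

section Sections

variable {B J K : Dia.Shape} (b : B) (F : J ⥤ K)

/-- The functor `k ↦ (b, k)`. -/
abbrev sect (b : B) (K : Dia.Shape) : K ⥤ Shape.prod B K := CategoryTheory.Prod.sectR b K

/-- The commutative square of `k ↦ (b, k)` and `F`. -/
def sectCell : sect b J ⋙ Shape.prodMap (𝟭 B) F ⟶ F ⋙ sect b K := eqToHom rfl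

/-- The transposed square of `sectCell`. -/
def sectCell' : F ⋙ sect b K ⟶ sect b J ⋙ Shape.prodMap (𝟭 B) F := eqToHom rfl

/-- The functor `J_{/k} ⥤ (B × J)_{/(b, k)}`. -/
def sliceOverSect (k : K) :
    Shape.sliceOver F k ⥤ Shape.sliceOver (Shape.prodMap (𝟭 B) F) ((b, k) : Shape.prod B K) where
  obj x := CostructuredArrow.mk (S := Shape.prodMap (𝟭 B) F) (Y := (b, x.left))
    ((𝟙 b, x.hom) : (b, F.obj x.left) ⟶ (b, k))
  map {x y} f := CostructuredArrow.homMk ((𝟙 b, f.left) : (b, x.left) ⟶ (b, y.left)) (by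
    ext
    · exact Category.id_comp _
    · exact CostructuredArrow.w f)
  map_comp f g := by
    ext
    · exact (Category.id_comp _).symm
    · rfl

/-- The functor `(B × J)_{/(b, k)} ⥤ J_{/k}`. -/
def sliceOverProj (k : K) :
    Shape.sliceOver (Shape.prodMap (𝟭 B) F) ((b, k) : Shape.prod B K) ⥤ Shape.sliceOver F k where
  obj x := CostructuredArrow.mk (S := F) (Y := x.left.2) (x.hom.2 : F.obj x.left.2 ⟶ k)
  map {x y} f := CostructuredArrow.homMk f.left.2 (congrArg Prod.snd (CostructuredArrow.w f))

/-- `sliceOverProj` is left adjoint to `sliceOverSect`. -/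
def sliceOverAdj (k : K) : sliceOverProj b F k ⊣ sliceOverSect b F k where
  unit :=
    { app x := CostructuredArrow.homMk ((x.hom.1, 𝟙 x.left.2) : x.left ⟶ (b, x.left.2)) (by
        ext
        · exact Category.comp_id _
        · change F.map (𝟙 _) ≫ x.hom.2 = x.hom.2
          simp)
      naturality x y f := by
        ext
        · have := congrArg Prod.fst (CostructuredArrow.w f)
          change f.left.1 ≫ y.hom.1 = x.hom.1 ≫ 𝟙 b
          simpa using this
        · exact (Category.comp_id _).trans (Category.id_comp _).symm }
  counit := { app x := CostructuredArrow.homMk (𝟙 x.left) (by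
                change F.map (𝟙 _) ≫ x.hom = x.hom
                simp)
              naturality x y f := by
                ext
                exact (Category.comp_id _).trans (Category.id_comp _).symm }
  left_triangle_components x := by
    ext
    exact Category.id_comp _
  right_triangle_components x := by
    ext
    · exact Category.id_comp _
    · exact Category.id_comp _

/-- The functor `J_{k/} ⥤ (B × J)_{(b, k)/}`. -/
def sliceUnderSect (k : K) :
    Shape.sliceUnder F k ⥤ Shape.sliceUnder (Shape.prodMap (𝟭 B) F) ((b, k) : Shape.prod B K) where
  obj x := StructuredArrow.mk (T := Shape.prodMap (𝟭 B) F) (Y := (b, x.right))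
    ((𝟙 b, x.hom) : (b, k) ⟶ (b, F.obj x.right))
  map {x y} f := StructuredArrow.homMk ((𝟙 b, f.right) : (b, x.right) ⟶ (b, y.right)) (by
    ext
    · exact Category.id_comp _
    · exact StructuredArrow.w f)
  map_comp f g := by
    ext
    · exact (Category.id_comp _).symm
    · rfl

/-- The functor `(B × J)_{(b, k)/} ⥤ J_{k/}`. -/
def sliceUnderProj (k : K) :
    Shape.sliceUnder (Shape.prodMap (𝟭 B) F) ((b, k) : Shape.prod B K) ⥤ Shape.sliceUnder F k where
  obj x := StructuredArrow.mk (T := F) (Y := x.right.2) (x.hom.2 : k ⟶ F.obj x.right.2)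
  map {x y} f := StructuredArrow.homMk f.right.2 (congrArg Prod.snd (StructuredArrow.w f))

/-- `sliceUnderProj` is right adjoint to `sliceUnderSect`. -/
def sliceUnderAdj (k : K) : sliceUnderSect b F k ⊣ sliceUnderProj b F k where
  counit :=
    { app x := StructuredArrow.homMk ((x.hom.1, 𝟙 x.right.2) : (b, x.right.2) ⟶ x.right) (by
        ext
        · exact Category.id_comp _
        · change x.hom.2 ≫ F.map (𝟙 _) = x.hom.2
          simp)
      naturality x y f := by
        ext
        · have := congrArg Prod.fst (StructuredArrow.w f)
          change 𝟙 b ≫ y.hom.1 = x.hom.1 ≫ f.right.1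
          simpa using this.symm
        · exact (Category.comp_id _).trans (Category.id_comp _).symm }
  unit := { app x := StructuredArrow.homMk (𝟙 x.right) (by
              change x.hom ≫ F.map (𝟙 _) = x.hom
              simp)
            naturality x y f := by
              ext
              exact (Category.comp_id _).trans (Category.id_comp _).symm }
  left_triangle_components x := by
    ext
    · exact Category.id_comp _
    · exact Category.id_comp _
  right_triangle_components x := by
    ext
    exact Category.id_comp _

/-- At each `k`, the slice square of `F` pasted with this one equals the slice square of `id_B × F`
at `(b, k)` restricted along `sliceOverSect`. That functor is a right adjoint, hence final, and
(Der4) applies. -/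
theorem leftExact_sectCell [D.IsDerivator] : D.LeftExact (sectCell b F) := by
  refine .of_pointwise _ fun k => ?_
  let G := Shape.prodMap (𝟭 B) F
  let bk : Shape.prod B K := (b, k)
  have h := (D.leftExact_finalCell (sliceOverAdj b F k)).paste (leftExact_overCell G bk)
  have e : pasteCell (F := sect b J) (F₂ := Shape.proj (Shape.sliceOver F k))
      (H' := Shape.point k) (overCell F k) (sectCell b F) =
    pasteCell (F := Shape.prOver G bk) (G := G) (F' := Shape.proj (Shape.sliceOver G bk))
      (G' := Shape.point bk) (F₂ := Shape.proj (Shape.sliceOver F k))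
      (H' := 𝟭 (Shape.final Dia)) (finalCell (sliceOverSect b F k)) (overCell G bk) := by
    ext x
    · rfl
    · exact (Category.id_comp x.hom).trans (Category.comp_id x.hom).symm
  rw [e]
  exact h

theorem rightExact_sectCell' [D.IsDerivator] : D.RightExact (sectCell' b F) := by
  refine .of_pointwise _ fun k => ?_
  let G := Shape.prodMap (𝟭 B) F
  let bk : Shape.prod B K := (b, k)
  have h := (D.rightExact_finalCell' (sliceUnderAdj b F k)).paste (rightExact_underCell G bk)
  have e : pasteCell' (F' := sect b J) (F₂ := Shape.proj (Shape.sliceUnder F k))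
      (H := Shape.point k) (underCell F k) (sectCell' b F) =
    pasteCell' (F' := Shape.prUnder G bk) (G' := G) (F := Shape.proj (Shape.sliceUnder G bk))
      (G := Shape.point bk) (F₂ := Shape.proj (Shape.sliceUnder F k))
      (H := 𝟭 (Shape.final Dia)) (finalCell' (sliceUnderSect b F k)) (underCell G bk) := by
    ext x
    · rfl
    · exact (Category.comp_id x.hom).trans (Category.id_comp x.hom).symm
  rw [e]
  exact h

end Sections

/-! ### Base change for the projections of a product -/

section Projections

variable {C E : Dia.Shape}

/-- The functor `c ↦ (c, k)`. -/
abbrev fiber (C : Dia.Shape) (k : E) : C ⥤ Shape.prod C E := CategoryTheory.Prod.sectL C k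

/-- The functor `c ↦ (c, k)` to the slice `(C × E)_{/k}` of the projection to `E`. -/
def sliceOverFiber (C : Dia.Shape) (k : E) : C ⥤ Shape.sliceOver (Shape.snd C E) k where
  obj c := CostructuredArrow.mk (S := Shape.snd C E) (Y := (c, k)) (𝟙 k)
  map {x y} f := CostructuredArrow.homMk ((f, 𝟙 k) : (x, k) ⟶ (y, k)) (Category.id_comp _)
  map_comp f g := by
    ext
    · rfl
    · exact (Category.id_comp _).symm

/-- The functor `c ↦ (c, k)` to the slice is a right adjoint. -/
def sliceOverFiberAdj (C : Dia.Shape) (k : E) :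
    Shape.prOver (Shape.snd C E) k ⋙ Shape.fst C E ⊣ sliceOverFiber C k where
  unit :=
    { app x := CostructuredArrow.homMk ((𝟙 x.left.1, x.hom) : x.left ⟶ (x.left.1, k))
        (Category.comp_id _)
      naturality x y f := by
        ext
        · exact (Category.comp_id _).trans (Category.id_comp _).symm
        · exact (CostructuredArrow.w f).trans (Category.comp_id _).symm }
  counit :=
    { app c := 𝟙 c
      naturality _ _ f := (Category.comp_id f).trans (Category.id_comp f).symm }
  left_triangle_components x := Category.id_comp _
  right_triangle_components x := by
    ext
    · exact Category.id_comp _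
    · exact Category.id_comp _

/-- The square of a fiber of the projection `C × E ⥤ E`. -/
def fiberCell (C : Dia.Shape) (k : E) :
    fiber C k ⋙ Shape.snd C E ⟶ Shape.proj C ⋙ Shape.point k := 𝟙 (fiber C k ⋙ Shape.snd C E)

/-- The fiber over `k` sits in the slice `(C × E)_{/k}` by a right adjoint, so it computes the left
Kan extension along the projection at `k`. -/
theorem leftExact_fiberCell [D.IsDerivator] (C : Dia.Shape) (k : E) :
    D.LeftExact (fiberCell C k) := by
  have h := (D.leftExact_finalCell (sliceOverFiberAdj C k)).paste
    (leftExact_overCell (Shape.snd C E) k)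
  have e : fiberCell C k = pasteCell (F := Shape.prOver (Shape.snd C E) k)
      (G := Shape.snd C E) (F' := Shape.proj (Shape.sliceOver (Shape.snd C E) k))
      (G' := Shape.point k) (F₂ := Shape.proj C) (H' := 𝟭 (Shape.final Dia))
      (finalCell (sliceOverFiber C k)) (overCell (Shape.snd C E) k) := by
    ext x
    exact (Category.id_comp (𝟙 k)).symm
  rw [e]
  exact h

/-- The square of the projections of `C × E`. -/
abbrev baseCell (C E : Dia.Shape) :
    Shape.fst C E ⋙ Shape.proj C ⟶ Shape.snd C E ⋙ Shape.proj E :=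
  𝟙 (Shape.fst C E ⋙ Shape.proj C)

theorem leftExact_baseCell [D.IsDerivator] (C E : Dia.Shape) : D.LeftExact (baseCell C E) := by
  refine .of_squares _ (fiberCell C) (leftExact_fiberCell C) fun k => ?_
  -- The composite `C ⥤ C × E ⥤ C` through the fiber over `k` is the identity, and 2-cells over the
  -- final category are unique.
  have e : pasteCell (F := Shape.fst C E) (F₂ := Shape.proj C) (H' := Shape.point k)
      (G := Shape.proj C) (G' := Shape.proj E)
      (fiberCell C k) (baseCell C E) = finalCell (𝟭 C) := Subsingleton.elim _ _
  rw [e]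
  exact D.leftExact_finalCell Adjunction.id

end Projections

end Prederivator

namespace Prederivator

variable {Dia : DiagramDomain.{u}}

/-! ### Strict morphisms of prederivators -/

/-- A strict morphism of prederivators. -/
structure StrictHom (D' D : Prederivator.{u, v, w} Dia) where
  app : ∀ K : Dia.Shape, D'.obj K ⥤ D.obj K
  comm : ∀ {J K : Dia.Shape} (F : J ⥤ K), D'.pull F ⋙ app J = app K ⋙ D.pull F
  comm_map : ∀ {J K : Dia.Shape} {F G : J ⥤ K} (α : F ⟶ G) (X : D'.obj K),
    (app J).map ((D'.pullMap α).app X) = eqToHom (Functor.congr_obj (comm F) X) ≫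
      (D.pullMap α).app ((app K).obj X) ≫ eqToHom (Functor.congr_obj (comm G) X).symm

namespace StrictHom

variable {D' D : Prederivator.{u, v, w} Dia} (Φ : StrictHom D' D)

theorem comm_obj {J K : Dia.Shape} (F : J ⥤ K) (X : D'.obj K) :
    (Φ.app J).obj ((D'.pull F).obj X) = (D.pull F).obj ((Φ.app K).obj X) :=
  Functor.congr_obj (Φ.comm F) X

theorem app_map_pull_map {J K : Dia.Shape} (F : J ⥤ K) {X Y : D'.obj K} (f : X ⟶ Y) :
    (Φ.app J).map ((D'.pull F).map f) = eqToHom (Φ.comm_obj F X) ≫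
      (D.pull F).map ((Φ.app K).map f) ≫ eqToHom (Φ.comm_obj F Y).symm :=
  Functor.congr_hom (Φ.comm F) f

theorem app_map_square_app {I J J' K : Dia.Shape} {F : I ⥤ J} {G : J ⥤ K} {F' : I ⥤ J'}
    {G' : J' ⥤ K} (α : F ⋙ G ⟶ F' ⋙ G') (Y : D'.obj K) :
    (Φ.app I).map ((D'.square α).app Y) =
      eqToHom ((Φ.comm_obj F _).trans (congrArg (D.pull F).obj (Φ.comm_obj G Y))) ≫
        (D.square α).app ((Φ.app K).obj Y) ≫
          eqToHom ((Φ.comm_obj F' _).trans (congrArg (D.pull F').obj (Φ.comm_obj G' Y))).symm := by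
  rw [square_app, square_app, Functor.map_comp, Functor.map_comp, Φ.comm_map]
  simp [eqToHom_map]

/-- The arrow to `F^*` that a strict morphism makes of an arrow to `F^*`. -/
def mapTo {J K : Dia.Shape} {F : J ⥤ K} {X : D'.obj J} {Y : D'.obj K} (f : X ⟶ (D'.pull F).obj Y) :
    (Φ.app J).obj X ⟶ (D.pull F).obj ((Φ.app K).obj Y) :=
  (Φ.app J).map f ≫ eqToHom (Φ.comm_obj F Y)

/-- The arrow from `F^*` that a strict morphism makes of an arrow from `F^*`. -/
def mapFrom {J K : Dia.Shape} {F : J ⥤ K} {X : D'.obj J} {Y : D'.obj K}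
    (f : (D'.pull F).obj Y ⟶ X) : (D.pull F).obj ((Φ.app K).obj Y) ⟶ (Φ.app J).obj X :=
  eqToHom (Φ.comm_obj F Y).symm ≫ (Φ.app J).map f

/-- A strict morphism is cocontinuous if it preserves left Kan extensions. -/
def IsCocontinuous : Prop :=
  ∀ ⦃J K : Dia.Shape⦄ (F : J ⥤ K) ⦃X : D'.obj J⦄ ⦃Y : D'.obj K⦄ (f : X ⟶ (D'.pull F).obj Y),
    IsUniversal (D'.pull F) f → IsUniversal (D.pull F) (Φ.mapTo f)

/-- A strict morphism is continuous if it preserves right Kan extensions. -/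
def IsContinuous : Prop :=
  ∀ ⦃J K : Dia.Shape⦄ (F : J ⥤ K) ⦃X : D'.obj J⦄ ⦃Y : D'.obj K⦄ (f : (D'.pull F).obj Y ⟶ X),
    IsCouniversal (D'.pull F) f → IsCouniversal (D.pull F) (Φ.mapFrom f)

theorem mapTo_comp_map {J K : Dia.Shape} {F : J ⥤ K} {X : D'.obj J} {Y Z : D'.obj K}
    (f : X ⟶ (D'.pull F).obj Y) (h : Y ⟶ Z) :
    Φ.mapTo (f ≫ (D'.pull F).map h) = Φ.mapTo f ≫ (D.pull F).map ((Φ.app K).map h) := by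
  simp [mapTo, app_map_pull_map]

theorem mapFrom_map_comp {J K : Dia.Shape} {F : J ⥤ K} {X : D'.obj J} {Y Z : D'.obj K}
    (f : (D'.pull F).obj Y ⟶ X) (h : Z ⟶ Y) :
    Φ.mapFrom ((D'.pull F).map h ≫ f) = (D.pull F).map ((Φ.app K).map h) ≫ Φ.mapFrom f := by
  simp [mapFrom, app_map_pull_map]

section Squares

variable {I J J' K : Dia.Shape} {F : I ⥤ J} {G : J ⥤ K} {F' : I ⥤ J'} {G' : J' ⥤ K}
  (α : F ⋙ G ⟶ F' ⋙ G')

theorem mapTo_square {X : D'.obj J} {Y : D'.obj K} (f : X ⟶ (D'.pull G).obj Y) :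
    Φ.mapTo (F := F') (Y := (D'.pull G').obj Y) ((D'.pull F).map f ≫ (D'.square α).app Y) =
      eqToHom (Φ.comm_obj F X) ≫
        ((D.pull F).map (Φ.mapTo f) ≫ (D.square α).app ((Φ.app K).obj Y)) ≫
          (D.pull F').map (eqToHom (Φ.comm_obj G' Y).symm) := by
  simp only [mapTo, Functor.map_comp, app_map_pull_map, app_map_square_app]
  simp [eqToHom_map]

theorem mapFrom_square {X : D'.obj J'} {Y : D'.obj K} (f : (D'.pull G').obj Y ⟶ X) :
    Φ.mapFrom (F := F) (Y := (D'.pull G).obj Y) ((D'.square α).app Y ≫ (D'.pull F').map f) =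
      (D.pull F).map (eqToHom (Φ.comm_obj G Y)) ≫
        ((D.square α).app ((Φ.app K).obj Y) ≫ (D.pull F').map (Φ.mapFrom f)) ≫
          eqToHom (Φ.comm_obj F' X).symm := by
  simp only [mapFrom, Functor.map_comp, app_map_pull_map, app_map_square_app]
  simp [eqToHom_map]

end Squares

end StrictHom

/-- A family of strict morphisms is jointly conservative. -/
def JointlyConservative {D' D : Prederivator.{u, v, w} Dia} {ι : Type*}
    (Φ : ι → StrictHom D' D) : Prop :=
  ∀ ⦃K : Dia.Shape⦄ ⦃X Y : D'.obj K⦄ (f : X ⟶ Y), (∀ i, IsIso (((Φ i).app K).map f)) → IsIso f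

namespace JointlyConservative

variable {D' D : Prederivator.{u, v, w} Dia} {ι : Type*} {Φ : ι → StrictHom D' D}

section Squares

variable {I J J' K : Dia.Shape} {F : I ⥤ J} {G : J ⥤ K} {F' : I ⥤ J'} {G' : J' ⥤ K}
  {α : F ⋙ G ⟶ F' ⋙ G'}

/-- Exactness in `D'` means that the comparison of the unit of `F'_!` with the transported arrow is
invertible. Each `Φ i` sends it to a comparison of universal arrows in `D`, because it preserves
left Kan extensions and `α` is exact in `D`. -/
theorem leftExact (hΦ : JointlyConservative Φ) (h : ∀ i, (Φ i).IsCocontinuous)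
    [D'.HasKanExtensions] (hα : D.LeftExact α) : D'.LeftExact α := by
  intro X Y f hf
  obtain ⟨k, hk, -⟩ := IsUniversal.of_adjunction (D'.lanAdj F') ((D'.pull F).obj X)
    ((D'.pull F).map f ≫ (D'.square α).app Y)
  have : IsIso k := by
    refine hΦ _ fun i => ?_
    have h₁ := h i F' _ (IsUniversal.of_adjunction (D'.lanAdj F') ((D'.pull F).obj X))
    have h₂ := hα _ (h i G f hf)
    refine h₁.isIso ((h₂.comp_iso (eqToHom ((Φ i).comm_obj G' Y).symm)).iso_comp
      (eqToHom ((Φ i).comm_obj F X))) ?_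
    rw [← StrictHom.mapTo_comp_map, hk, StrictHom.mapTo_square]
  rw [← hk]
  exact (IsUniversal.of_adjunction (D'.lanAdj F') _).comp_iso k

theorem rightExact (hΦ : JointlyConservative Φ) (h : ∀ i, (Φ i).IsContinuous)
    [D'.HasKanExtensions] (hα : D.RightExact α) : D'.RightExact α := by
  intro X Y f hf
  obtain ⟨k, hk, -⟩ := IsCouniversal.of_adjunction (D'.ranAdj F) ((D'.pull F').obj X)
    ((D'.square α).app Y ≫ (D'.pull F').map f)
  have : IsIso k := by
    refine hΦ _ fun i => ?_
    have h₁ := h i F _ (IsCouniversal.of_adjunction (D'.ranAdj F) ((D'.pull F').obj X))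
    have h₂ := hα _ (h i G' f hf)
    refine h₁.isIso ((h₂.comp_iso (eqToHom ((Φ i).comm_obj F' X).symm)).iso_comp
      (eqToHom ((Φ i).comm_obj G Y))) ?_
    rw [← StrictHom.mapFrom_map_comp, hk, StrictHom.mapFrom_square]
  rw [← hk]
  exact (IsCouniversal.of_adjunction (D'.ranAdj F) _).iso_comp k

end Squares

theorem isIso_iff (hΦ : JointlyConservative Φ) [D.IsDerivator] {K : Dia.Shape} {X Y : D'.obj K}
    (f : X ⟶ Y) : IsIso f ↔ ∀ k : K, IsIso ((D'.pull (Shape.point k)).map f) := by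
  refine ⟨fun _ k => inferInstance, fun H => hΦ f fun i => ?_⟩
  rw [IsDerivator.der2]
  intro k
  refine (isIso_map_iff_of_eq ((Φ i).comm (Shape.point k)) f).mp ?_
  have := H k
  exact inferInstanceAs (IsIso (((Φ i).app _).map ((D'.pull (Shape.point k)).map f)))

theorem isDerivator (hΦ : JointlyConservative Φ) (h : ∀ i, (Φ i).IsCocontinuous)
    (h' : ∀ i, (Φ i).IsContinuous) [D.IsDerivator] [D'.HasKanExtensions]
    (h₁ : ∀ (ι : Type u) (K : ι → Dia.Shape) (h : Dia.mem (Σ i, (K i : Type u))),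
      (Functor.pi' fun i => D'.pull (Shape.incl K h i)).IsEquivalence) : D'.IsDerivator where
  der1 := h₁
  der2 _ _ _ f := hΦ.isIso_iff f
  der4_left F k := (isIso_leftMate_iff _).mpr (hΦ.leftExact h (leftExact_overCell F k))
  der4_right F k := (isIso_rightMate_iff _).mpr (hΦ.rightExact h' (rightExact_underCell F k))

end JointlyConservative

/-! ### The canonical morphism -/

section Canonical

variable {D : Prederivator.{u, v, w} Dia} {C E : Dia.Shape} {Y : D.obj (Shape.prod C E)}

/-- `c` is the canonical morphism, computed with arbitrary choices of the Kan extensions. -/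
def Canonical {R : D.obj C} {L : D.obj (Shape.final Dia)} {M : D.obj E}
    {N : D.obj (Shape.final Dia)} (ε : (D.pull (Shape.fst C E)).obj R ⟶ Y)
    (η : R ⟶ (D.pull (Shape.proj C)).obj L) (θ : Y ⟶ (D.pull (Shape.snd C E)).obj M)
    (ζ : (D.pull (Shape.proj E)).obj N ⟶ M) (c : L ⟶ N) : Prop :=
  (D.pull (Shape.fst C E)).map η ≫ (D.square (baseCell C E)).app L ≫
    (D.pull (Shape.snd C E)).map ((D.pull (Shape.proj E)).map c ≫ ζ) = ε ≫ θ

/-- Precomposing the defining equation with the unit of `(π_C × id_E)_!` loses nothing, and turns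
the base change mate into the square itself. The resulting equation makes sense for any universal
arrows. -/
theorem isCanonical_iff [D.HasKanExtensions]
    (c : (D.lan (Shape.proj C)).obj ((D.ran (Shape.fst C E)).obj Y) ⟶
      (D.ran (Shape.proj E)).obj ((D.lan (Shape.snd C E)).obj Y)) :
    D.IsCanonical C E Y c ↔ Canonical ((D.ranAdj (Shape.fst C E)).counit.app Y)
      ((D.lanAdj (Shape.proj C)).unit.app _) ((D.lanAdj (Shape.snd C E)).unit.app Y)
      ((D.ranAdj (Shape.proj E)).counit.app _) c := by
  have h₁ := unit_leftMate (D := D) (baseCell C E) ((D.ran (Shape.fst C E)).obj Y)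
  have h₂ := (D.lanAdj (Shape.snd C E)).unit.naturality ((D.ranAdj (Shape.fst C E)).counit.app Y)
  have h₃ : ((D.ranAdj (Shape.proj E)).homEquiv _ _).symm c =
      (D.pull (Shape.proj E)).map c ≫ (D.ranAdj (Shape.proj E)).counit.app _ :=
    Adjunction.homEquiv_counit ..
  unfold IsCanonical Canonical
  rw [h₃]
  have h₄ := (reassoc_of% h₁) ((D.pull (Shape.snd C E)).map ((D.pull (Shape.proj E)).map c ≫
    (D.ranAdj (Shape.proj E)).counit.app ((D.lan (Shape.snd C E)).obj Y)))
  change ((D.ranAdj (Shape.fst C E)).counit.app Y) ≫ _ = _ at h₂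
  erw [← h₄, ← Functor.map_comp, h₂]
  exact ⟨fun h => congrArg _ (congrArg _ h),
    fun h => (IsUniversal.of_adjunction (D.lanAdj (Shape.snd C E)) _).hom_ext h⟩

/-- Invertibility of the canonical morphism does not depend on the choice of Kan extensions. This is
needed because a strict morphism sends the chosen ones to others. -/
theorem Canonical.isIso [D.IsDerivator] {R R' : D.obj C} {L L' : D.obj (Shape.final Dia)}
    {M M' : D.obj E} {N N' : D.obj (Shape.final Dia)}
    {ε : (D.pull (Shape.fst C E)).obj R ⟶ Y}
    {η : R ⟶ (D.pull (Shape.proj C)).obj L} {θ : Y ⟶ (D.pull (Shape.snd C E)).obj M}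
    {ζ : (D.pull (Shape.proj E)).obj N ⟶ M} {c : L ⟶ N}
    {ε' : (D.pull (Shape.fst C E)).obj R' ⟶ Y}
    {η' : R' ⟶ (D.pull (Shape.proj C)).obj L'} {θ' : Y ⟶ (D.pull (Shape.snd C E)).obj M'}
    {ζ' : (D.pull (Shape.proj E)).obj N' ⟶ M'} {c' : L' ⟶ N'}
    (hε : IsCouniversal _ ε) (hη : IsUniversal _ η) (hθ : IsUniversal _ θ) (hζ : IsCouniversal _ ζ)
    (hε' : IsCouniversal _ ε') (hη' : IsUniversal _ η') (hθ' : IsUniversal _ θ')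
    (hζ' : IsCouniversal _ ζ') (h : Canonical ε η θ ζ c) (h' : Canonical ε' η' θ' ζ' c')
    [IsIso c] : IsIso c' := by
  obtain ⟨r, _, hr⟩ := hε.exists_iso hε'
  obtain ⟨l, _, hl⟩ := (hη.iso_comp r).exists_iso hη'
  obtain ⟨m, _, hm⟩ := hθ.exists_iso hθ'
  obtain ⟨n, _, hn⟩ := hζ'.exists_iso (hζ.comp_iso m)
  -- A morphism `L ⟶ N'` is determined by its transpose on `C × E`, by couniversality of `ζ'` and
  -- base change; both transposes reduce to `ε' ≫ θ'` preceded by no further choices.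
  have key : c ≫ n = l ≫ c' := by
    refine hζ'.hom_ext ((leftExact_baseCell C E _ (hη.iso_comp r)).hom_ext ?_)
    have hn' := congrArg (D.pull (Shape.snd C E)).map hn
    rw [Functor.map_comp, Functor.map_comp] at hn'
    simp only [Functor.map_comp, Category.assoc, hn']
    unfold Canonical at h h'
    have e := D.square_naturality (baseCell C E) l
    calc _ = (D.pull (Shape.fst C E)).map r ≫ ((D.pull (Shape.fst C E)).map η ≫
          (D.square (baseCell C E)).app L ≫
            (D.pull (Shape.snd C E)).map ((D.pull (Shape.proj E)).map c ≫ ζ)) ≫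
              (D.pull (Shape.snd C E)).map m := by simp
      _ = ε' ≫ θ' := by rw [h, ← hr, ← hm]; simp
      _ = _ := by
        rw [← h', ← hl]
        simp only [Functor.map_comp, Category.assoc]
        rw [reassoc_of% e]
  have : c' = inv l ≫ c ≫ n := by rw [key]; simp
  rw [this]
  infer_instance

theorem Canonical.map {D' : Prederivator.{u, v, w} Dia} (Φ : StrictHom D' D)
    {Y : D'.obj (Shape.prod C E)} {R : D'.obj C} {L : D'.obj (Shape.final Dia)} {M : D'.obj E}
    {N : D'.obj (Shape.final Dia)} {ε : (D'.pull (Shape.fst C E)).obj R ⟶ Y}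
    {η : R ⟶ (D'.pull (Shape.proj C)).obj L} {θ : Y ⟶ (D'.pull (Shape.snd C E)).obj M}
    {ζ : (D'.pull (Shape.proj E)).obj N ⟶ M} {c : L ⟶ N} (h : Canonical ε η θ ζ c) :
    Canonical (Φ.mapFrom ε) (Φ.mapTo η) (Φ.mapTo θ) (Φ.mapFrom ζ) ((Φ.app _).map c) := by
  unfold Canonical at h ⊢
  have h₁ := congrArg (Φ.mapTo (F := Shape.snd C E)) ((Category.assoc _ _ _).trans h)
  have h₂ : Φ.mapFrom ((D'.pull (Shape.proj E)).map c ≫ ζ) = _ := Φ.mapFrom_map_comp ζ c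
  have h₃ : Φ.mapTo (ε ≫ θ) = (Φ.app _).map ε ≫ Φ.mapTo θ := by simp [StrictHom.mapTo]
  rw [Φ.mapTo_comp_map, Φ.mapTo_square, h₃] at h₁
  rw [← h₂, StrictHom.mapFrom, StrictHom.mapFrom, Category.assoc, ← h₁]
  simp

theorem JointlyConservative.isRegular {D' : Prederivator.{u, v, w} Dia} {ι : Type*}
    {Φ : ι → StrictHom D' D} (hΦ : JointlyConservative Φ) (h : ∀ i, (Φ i).IsCocontinuous)
    (h' : ∀ i, (Φ i).IsContinuous) [D.IsDerivator] [D'.HasKanExtensions]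
    {Fin : Dia.Shape → Prop} (hD : D.IsRegular Fin) : D'.IsRegular Fin := by
  intro C E hC hE Y
  -- Base change in `D'` factors `ε ≫ θ` uniquely through the left Kan extension; transposing the
  -- factor along `π_E^* ⊣ π_{E,*}` gives the canonical morphism.
  obtain ⟨k, hk, -⟩ := (hΦ.leftExact h (leftExact_baseCell C E)) _
    (IsUniversal.of_adjunction (D'.lanAdj (Shape.proj C)) ((D'.ran (Shape.fst C E)).obj Y))
    ((D'.ranAdj (Shape.fst C E)).counit.app Y ≫ (D'.lanAdj (Shape.snd C E)).unit.app Y)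
  obtain ⟨c, rfl, -⟩ := IsCouniversal.of_adjunction (D'.ranAdj (Shape.proj E)) _ k
  have hc : D'.IsCanonical C E Y c :=
    (isCanonical_iff c).mpr ((Category.assoc _ _ _).symm.trans hk)
  refine ⟨c, hc, hΦ c fun i => ?_⟩
  obtain ⟨c₀, hc₀, _⟩ := hD C E hC hE (((Φ i).app _).obj Y)
  exact ((isCanonical_iff c₀).mp hc₀).isIso (.of_adjunction _ _) (.of_adjunction _ _)
    (.of_adjunction _ _) (.of_adjunction _ _) (h' i _ _ (.of_adjunction _ _))
    (h i _ _ (.of_adjunction _ _)) (h i _ _ (.of_adjunction _ _))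
    (h' i _ _ (.of_adjunction _ _)) (((isCanonical_iff c).mp hc).map (Φ i))

end Canonical

end Prederivator

/-! ### Zero objects and their pointwise detection -/

/-- For a zero object `Z` of `C`, the only arrow `X ⟶ R Z` is universal too, so `Y` is isomorphic to
`Z`. -/
theorem IsUniversal.isZero {C E : Type*} [Category C] [Category E] {R : C ⥤ E} {X : E} {Y : C}
    {f : X ⟶ R.obj Y} (hf : IsUniversal R f) (hX : IsZero X) [HasZeroObject C] : IsZero Y := by
  obtain ⟨Z, hZ⟩ := HasZeroObject.zero (C := C)
  have hZ' : IsUniversal R (hX.to_ (R.obj Z)) := fun W g =>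
    ⟨hZ.to_ W, hX.eq_of_src _ _, fun _ _ => hZ.eq_of_src _ _⟩
  obtain ⟨h, _, -⟩ := hf.exists_iso hZ'
  exact hZ.of_iso (asIso h)

theorem IsCouniversal.isZero {C E : Type*} [Category C] [Category E] {R : C ⥤ E} {X : E} {Y : C}
    {f : R.obj Y ⟶ X} (hf : IsCouniversal R f) (hX : IsZero X) [HasZeroObject C] : IsZero Y := by
  obtain ⟨Z, hZ⟩ := HasZeroObject.zero (C := C)
  have hZ' : IsCouniversal R (hX.from_ (R.obj Z)) := fun W g =>
    ⟨hZ.from_ W, hX.eq_of_tgt _ _, fun _ _ => hZ.eq_of_tgt _ _⟩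
  obtain ⟨h, _, -⟩ := hf.exists_iso hZ'
  exact hZ.of_iso (asIso h).symm

namespace Prederivator

variable {Dia : DiagramDomain.{u}} {D : Prederivator.{u, v, w} Dia}

theorem IsPointed.hasZeroObject [D.HasKanExtensions] (hD : D.IsPointed) (K : Dia.Shape) :
    HasZeroObject (D.obj K) := by
  obtain ⟨Z, hZ⟩ := hD.zero
  exact ⟨_, D.isZero_pull (Shape.proj K) hZ⟩

theorem IsPointed.isZero_iff [D.IsDerivator] (hD : D.IsPointed) {K : Dia.Shape} (X : D.obj K) :
    IsZero X ↔ ∀ k : K, IsZero ((D.pull (Shape.point k)).obj X) := by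
  refine ⟨fun h k => D.isZero_pull _ h, fun h => ?_⟩
  obtain ⟨Z, hZ⟩ := (hD.hasZeroObject K).zero
  have : IsIso (hZ.from_ X) := by
    rw [IsDerivator.der2]
    intro k
    have hZ' := D.isZero_pull (Shape.point k) hZ
    exact ⟨hZ'.to_ _, (h k).eq_of_src _ _, hZ'.eq_of_src _ _⟩
  exact hZ.of_iso (asIso (hZ.from_ X))

/-! ### Kan extensions and values of vanishing objects -/

section Vanishing

variable {A B : Dia.Shape} (i : A ⥤ B)

theorem IsPointed.vanishes_iff [D.IsDerivator] (hD : D.IsPointed) {K : Dia.Shape}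
    (X : D.obj (Shape.prod B K)) : D.vanishes i K X ↔
      ∀ (a : A) (k : K),
        IsZero ((D.pull (Shape.point ((i.obj a, k) : Shape.prod B K))).obj X) := by
  have e : ∀ (a : A) (k : K), Shape.point ((i.obj a, k) : Shape.prod B K) =
      Shape.point ((a, k) : Shape.prod A K) ⋙ Shape.prodMap i (𝟭 K) := fun a k => by
    refine CategoryTheory.Functor.ext (fun _ => rfl) fun x y f => ?_
    ext <;> simp
  refine (hD.isZero_iff _).trans ⟨fun h a k => ?_, fun h x => ?_⟩
  · rw [e, pull_obj_comp]
    exact h (a, k)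
  · have := h x.1 x.2
    rw [e, pull_obj_comp] at this
    exact this

theorem IsPointed.vanishes_iff_sect [D.IsDerivator] (hD : D.IsPointed) {K : Dia.Shape}
    (X : D.obj (Shape.prod B K)) : D.vanishes i K X ↔
      ∀ a : A, IsZero ((D.pull (sect (i.obj a) K)).obj X) := by
  rw [hD.vanishes_iff]
  refine forall_congr' fun a => (Iff.trans (forall_congr' fun k => ?_) (hD.isZero_iff _).symm)
  rw [← pull_obj_comp]
  rfl

/-- At `i a`, exactness of `sectCell` makes the value of `Y` a left Kan extension of the value of
`X`, which is zero. -/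
theorem IsPointed.vanishes_of_isUniversal [D.IsDerivator] (hD : D.IsPointed) {J K : Dia.Shape}
    (F : J ⥤ K) {X : D.obj (Shape.prod B J)} {Y : D.obj (Shape.prod B K)}
    {f : X ⟶ (D.pull (Shape.prodMap (𝟭 B) F)).obj Y} (hf : IsUniversal _ f)
    (hX : D.vanishes i J X) : D.vanishes i K Y := by
  rw [hD.vanishes_iff_sect] at hX ⊢
  have := hD.hasZeroObject K
  exact fun a => (leftExact_sectCell (i.obj a) F f hf).isZero (hX a)

theorem IsPointed.vanishes_of_isCouniversal [D.IsDerivator] (hD : D.IsPointed) {J K : Dia.Shape}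
    (F : J ⥤ K) {X : D.obj (Shape.prod B J)} {Y : D.obj (Shape.prod B K)}
    {f : (D.pull (Shape.prodMap (𝟭 B) F)).obj Y ⟶ X} (hf : IsCouniversal _ f)
    (hX : D.vanishes i J X) : D.vanishes i K Y := by
  rw [hD.vanishes_iff_sect] at hX ⊢
  have := hD.hasZeroObject K
  exact fun a => (rightExact_sectCell' (i.obj a) F f hf).isZero (hX a)

theorem isUniversal_vanishing [D.HasKanExtensions] {J K : Dia.Shape} {F : J ⥤ K}
    {X : (D.vanishing i).obj J} {Y : (D.vanishing i).obj K}
    {f : X ⟶ ((D.vanishing i).pull F).obj Y}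
    (hf : IsUniversal (D.pull (Shape.prodMap (𝟭 B) F)) (Y := Y.obj) f.hom) :
    IsUniversal ((D.vanishing i).pull F) f := by
  intro Z g
  obtain ⟨h, h₁, h₂⟩ := hf (Z := Z.obj) g.hom
  exact ⟨ObjectProperty.homMk h, ObjectProperty.hom_ext _ h₁, fun k hk =>
    ObjectProperty.hom_ext _ (h₂ _ (congrArg (·.hom) hk))⟩

theorem isCouniversal_vanishing [D.HasKanExtensions] {J K : Dia.Shape} {F : J ⥤ K}
    {X : (D.vanishing i).obj J} {Y : (D.vanishing i).obj K}
    {f : ((D.vanishing i).pull F).obj Y ⟶ X}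
    (hf : IsCouniversal (D.pull (Shape.prodMap (𝟭 B) F)) (Y := Y.obj) f.hom) :
    IsCouniversal ((D.vanishing i).pull F) f := by
  intro Z g
  obtain ⟨h, h₁, h₂⟩ := hf (Z := Z.obj) g.hom
  exact ⟨ObjectProperty.homMk h, ObjectProperty.hom_ext _ h₁, fun k hk =>
    ObjectProperty.hom_ext _ (h₂ _ (congrArg (·.hom) hk))⟩

/-- The arrow is universal in the ambient `D(B × -)`, which is stronger than universality among
vanishing objects and is what `isCocontinuous_value` needs. -/
theorem IsPointed.exists_isUniversal [D.IsDerivator] (hD : D.IsPointed) {J K : Dia.Shape}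
    (F : J ⥤ K) (X : (D.vanishing i).obj J) :
    ∃ (Y : (D.vanishing i).obj K) (f : X ⟶ ((D.vanishing i).pull F).obj Y),
      IsUniversal (D.pull (Shape.prodMap (𝟭 B) F)) (Y := Y.obj) f.hom :=
  have hη := IsUniversal.of_adjunction (D.lanAdj (Shape.prodMap (𝟭 B) F)) X.obj
  ⟨⟨_, hD.vanishes_of_isUniversal i F hη X.property⟩, ObjectProperty.homMk _, hη⟩

theorem IsPointed.exists_isCouniversal [D.IsDerivator] (hD : D.IsPointed) {J K : Dia.Shape}
    (F : J ⥤ K) (X : (D.vanishing i).obj J) :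
    ∃ (Y : (D.vanishing i).obj K) (f : ((D.vanishing i).pull F).obj Y ⟶ X),
      IsCouniversal (D.pull (Shape.prodMap (𝟭 B) F)) (Y := Y.obj) f.hom :=
  have hε := IsCouniversal.of_adjunction (D.ranAdj (Shape.prodMap (𝟭 B) F)) X.obj
  ⟨⟨_, hD.vanishes_of_isCouniversal i F hε X.property⟩, ObjectProperty.homMk _, hε⟩

theorem IsPointed.hasKanExtensions_vanishing [D.IsDerivator] (hD : D.IsPointed) :
    (D.vanishing i).HasKanExtensions where
  isRightAdjoint F := isRightAdjoint_of_isUniversal fun X => by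
    obtain ⟨Y, f, hf⟩ := hD.exists_isUniversal i F X
    exact ⟨Y, f, isUniversal_vanishing i hf⟩
  isLeftAdjoint F := isLeftAdjoint_of_isCouniversal fun X => by
    obtain ⟨Y, f, hf⟩ := hD.exists_isCouniversal i F X
    exact ⟨Y, f, isCouniversal_vanishing i hf⟩

theorem IsPointed.isPointed_vanishing [D.IsDerivator] (hD : D.IsPointed) :
    (D.vanishing i).IsPointed := by
  obtain ⟨Z, hZ⟩ := (hD.hasZeroObject (Shape.prod B (Shape.final Dia))).zero
  refine ⟨⟨⟨Z, D.isZero_pull _ hZ⟩, ⟨fun Y => ?_, fun Y => ?_⟩⟩⟩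
  · exact ⟨⟨⟨ObjectProperty.homMk (hZ.to_ Y.obj)⟩, fun f =>
      ObjectProperty.hom_ext _ (hZ.eq_of_src _ _)⟩⟩
  · exact ⟨⟨⟨ObjectProperty.homMk (hZ.from_ Y.obj)⟩, fun f =>
      ObjectProperty.hom_ext _ (hZ.eq_of_tgt _ _)⟩⟩

/-- The value at an object of `B`. -/
def value [D.HasKanExtensions] (b : B) : StrictHom (D.vanishing i) D where
  app K := (D.vanishes i K).ι ⋙ D.pull (sect b K)
  comm {J K} F := by
    have e : D.pull (Shape.prodMap (𝟭 B) F) ⋙ D.pull (sect b J) =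
        D.pull (sect b K) ⋙ D.pull F := by
      rw [← D.pull_comp, ← D.pull_comp]
      rfl
    exact congrArg ((D.vanishes i K).ι ⋙ ·) e
  comm_map {J K F G} α X := by
    have h₁ := NatTrans.congr_app (D.pullMap_whiskerLeft (sect b J) (idProdMap B α)) X.obj
    have h₂ := NatTrans.congr_app (D.pullMap_whiskerRight α (sect b K)) X.obj
    have e : Functor.whiskerLeft (sect b J) (idProdMap B α) = Functor.whiskerRight α (sect b K) :=
      rfl
    have h₃ := h₁.symm.trans ((NatTrans.congr_app (congrArg D.pullMap e) X.obj).trans h₂)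
    simp only [NatTrans.comp_app, eqToHom_app, Functor.whiskerRight_app,
      Functor.whiskerLeft_app] at h₃
    exact eq_eqToHom_conj h₃

theorem jointlyConservative_value [D.IsDerivator] :
    JointlyConservative (D := D) (value i) := by
  intro K X Y f hf
  have : IsIso ((D.vanishes i K).ι.map f) := by
    rw [IsDerivator.der2]
    rintro ⟨b, k⟩
    have h := hf b
    rw [IsDerivator.der2] at h
    exact (isIso_map_iff_of_eq (D.pull_comp (Shape.point k) (sect b K)) f.hom).mpr (h k)
  obtain ⟨g, h₁, h₂⟩ := this
  exact ⟨ObjectProperty.homMk g, ObjectProperty.hom_ext _ h₁, ObjectProperty.hom_ext _ h₂⟩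

theorem IsPointed.isCocontinuous_value [D.IsDerivator] (hD : D.IsPointed) (b : B) :
    (value (D := D) i b).IsCocontinuous := by
  intro J K F X Y f hf
  -- `f` is only known to be universal among vanishing objects. It differs by an isomorphism from an
  -- arrow `g` that is universal in `D(B × -)`, to which `leftExact_sectCell` applies.
  obtain ⟨Z, g, hg⟩ := hD.exists_isUniversal i F X
  obtain ⟨h, _, rfl⟩ := (isUniversal_vanishing i hg).exists_iso hf
  rw [StrictHom.mapTo_comp_map]
  refine IsUniversal.comp_iso ?_ _
  have := leftExact_sectCell b F _ hg
  rw [D.square_app_of_eq_eqToHom (F := sect b J) (G := Shape.prodMap (𝟭 B) F) (F' := F)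
    (G' := sect b K) (α := sectCell b F) rfl rfl Z.obj] at this
  exact this

theorem IsPointed.isContinuous_value [D.IsDerivator] (hD : D.IsPointed) (b : B) :
    (value (D := D) i b).IsContinuous := by
  intro J K F X Y f hf
  obtain ⟨Z, g, hg⟩ := hD.exists_isCouniversal i F X
  obtain ⟨h, _, rfl⟩ := (isCouniversal_vanishing i hg).exists_iso hf
  rw [StrictHom.mapFrom_map_comp]
  refine IsCouniversal.iso_comp ?_ _
  have := rightExact_sectCell' b F _ hg
  rw [D.square_app_of_eq_eqToHom (F := F) (G := sect b K) (F' := sect b J)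
    (G' := Shape.prodMap (𝟭 B) F) (α := sectCell' b F) rfl rfl Z.obj] at this
  exact this

end Vanishing

/-! ### Disjoint unions -/

section Coproducts

variable {ι : Type u} (B : Dia.Shape) (K : ι → Dia.Shape)

/-- The functor `∐ (B × K_i) ⥤ B × ∐ K_i`. -/
def sigmaProd : (Σ i, (Shape.prod B (K i) : Type u)) ⥤ B.carrier × (Σ i, (K i).carrier) :=
  CategoryTheory.Sigma.desc fun i => Functor.prod (𝟭 B) (CategoryTheory.Sigma.incl (C := fun i => (K i : Type u)) i)

/-- The functor `B × ∐ K_i ⥤ ∐ (B × K_i)`. -/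
def prodSigma : B.carrier × (Σ i, (K i).carrier) ⥤ (Σ i, (Shape.prod B (K i) : Type u)) where
  obj x := ⟨x.2.1, (x.1, x.2.2)⟩
  map {x y} f := match x, y, f with
    | (_, ⟨_, _⟩), (_, ⟨_, _⟩), (f, CategoryTheory.Sigma.SigmaHom.mk g) => CategoryTheory.Sigma.SigmaHom.mk (f, g)
  map_id _ := rfl
  map_comp := by
    rintro ⟨_, _, _⟩ ⟨_, _, _⟩ ⟨_, _, _⟩ ⟨f, ⟨g⟩⟩ ⟨f', ⟨g'⟩⟩
    rfl

theorem prodSigma_sigmaProd : prodSigma B K ⋙ sigmaProd B K = 𝟭 _ := by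
  refine CategoryTheory.Functor.ext (fun _ => rfl) ?_
  rintro ⟨_, _, _⟩ ⟨_, _, _⟩ ⟨f, ⟨g⟩⟩
  exact ((Category.id_comp _).trans (Category.comp_id _)).symm

theorem sigmaProd_prodSigma : sigmaProd B K ⋙ prodSigma B K = 𝟭 _ := by
  refine CategoryTheory.Functor.ext (fun _ => rfl) ?_
  rintro ⟨_, _, _⟩ ⟨_, _, _⟩ ⟨f, g⟩
  exact ((Category.id_comp _).trans (Category.comp_id _)).symm

theorem isEquivalence_pull_prod_incl [D.IsDerivator] (h : Dia.mem (Σ i, (K i : Type u))) :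
    (Functor.pi' fun i => D.pull (Shape.prodMap (𝟭 B) (Shape.incl K h i))).IsEquivalence := by
  -- (Der1) is to be applied to the family `B × K_i`; its disjoint union lies in the domain because
  -- it is isomorphic to `B × ∐ K_i`.
  have h' : Dia.mem (Σ i, (Shape.prod B (K i) : Type u)) :=
    Dia.mem_of_iso _ _ (prodSigma B K) (sigmaProd B K) (prodSigma_sigmaProd B K)
      (sigmaProd_prodSigma B K) (Shape.prod B (Shape.coprod K h)).isMem
  let G : Shape.coprod (fun i => Shape.prod B (K i)) h' ⥤ Shape.prod B (Shape.coprod K h) :=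
    sigmaProd B K
  let G' : Shape.prod B (Shape.coprod K h) ⥤ Shape.coprod (fun i => Shape.prod B (K i)) h' :=
    prodSigma B K
  have e₁ : D.pull G ⋙ D.pull G' = 𝟭 _ := by
    rw [← D.pull_comp, ← D.pull_id]
    exact congrArg D.pull (prodSigma_sigmaProd B K)
  have e₂ : D.pull G' ⋙ D.pull G = 𝟭 _ := by
    rw [← D.pull_comp, ← D.pull_id]
    exact congrArg D.pull (sigmaProd_prodSigma B K)
  have : (D.pull G).IsEquivalence :=
    (CategoryTheory.Equivalence.mk (D.pull G) (D.pull G') (eqToIso e₁.symm) (eqToIso e₂)).isEquivalence_functor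
  have := IsDerivator.der1 (D := D) ι (fun i => Shape.prod B (K i)) h'
  have e : (Functor.pi' fun i => D.pull (Shape.prodMap (𝟭 B) (Shape.incl K h i))) =
      D.pull G ⋙ Functor.pi' fun i => D.pull (Shape.incl (fun i => Shape.prod B (K i)) h' i) :=
    congrArg Functor.pi' (funext fun i =>
      D.pull_comp (Shape.incl (fun i => Shape.prod B (K i)) h' i) G)
  rw [e]
  infer_instance

/-- Full faithfulness is inherited from the ambient equivalence. For essential surjectivity,
vanishing is tested at the objects `(i a, (j, k))`, each of which lies in a single summand. -/
theorem IsPointed.der1_vanishing [D.IsDerivator] (hD : D.IsPointed) {A B : Dia.Shape} (i : A ⥤ B)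
    (h : Dia.mem (Σ i, (K i : Type u))) :
    (Functor.pi' fun j => (D.vanishing i).pull (Shape.incl K h j)).IsEquivalence := by
  have hT := isEquivalence_pull_prod_incl (D := D) B K h
  set T := Functor.pi' fun i => D.pull (Shape.prodMap (𝟭 B) (Shape.incl K h i)) with hT'
  refine { faithful := ⟨fun {X Y f g} e => ?_⟩, full := ⟨fun {X Y} f => ?_⟩, essSurj := ⟨fun Y => ?_⟩ }
  · refine ObjectProperty.hom_ext _ (T.map_injective (funext fun j => ?_))
    exact congrArg (·.hom) (congrFun e j)
  · obtain ⟨g, hg⟩ := T.map_surjective (X := X.obj) (Y := Y.obj) (fun j => (f j).hom)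
    exact ⟨ObjectProperty.homMk g, funext fun j => ObjectProperty.hom_ext _ (congrFun hg j)⟩
  · let e := T.objObjPreimageIso fun j => (Y j).obj
    have hX : D.vanishes i _ (T.objPreimage fun j => (Y j).obj) := by
      rw [hD.vanishes_iff]
      rintro a ⟨j, k⟩
      have h₁ := (hD.vanishes_iff i _).mp (Y j).property a k
      have h₂ := h₁.of_iso ((D.pull (Shape.point ((i.obj a, k) : Shape.prod B (K j)))).mapIso
        (Pi.isoApp e j))
      have h₃ := D.pull_obj_comp (Shape.point ((i.obj a, k) : Shape.prod B (K j)))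
        (Shape.prodMap (𝟭 B) (Shape.incl K h j)) (T.objPreimage fun j => (Y j).obj)
      have h₄ := (congrArg IsZero h₃).mpr h₂
      exact h₄
    exact ⟨⟨_, hX⟩, ⟨Pi.isoMk fun j => (D.vanishes i (K j)).isoMk (Pi.isoApp e j)⟩⟩

end Coproducts

/-- The argument is uniform in the class of finite shapes, so both readings of "finite category" are
instances. -/
theorem IsPointed.isRegularPointedDerivator_vanishing [D.IsDerivator] (hD : D.IsPointed)
    {A B : Dia.Shape} (i : A ⥤ B) {Fin : Dia.Shape → Prop} (h : D.IsRegular Fin) :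
    (D.vanishing i).IsRegularPointedDerivator Fin :=
  have := hD.hasKanExtensions_vanishing i
  { toIsDerivator := (jointlyConservative_value i).isDerivator (hD.isCocontinuous_value i)
      (hD.isContinuous_value i) fun _ K h => hD.der1_vanishing K i h
    isPointed := hD.isPointed_vanishing i
    isRegular := (jointlyConservative_value i).isRegular (hD.isCocontinuous_value i)
      (hD.isContinuous_value i) h }

end Prederivator

theorem mainTheorem9 {Dia : DiagramDomain.{u}} (D : Prederivator.{u, v, w} Dia)
    [D.IsDerivator] (hD : D.IsPointed) :
    (D.IsRegular DiagramDomain.Shape.IsFinite →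
      D.Sp.IsRegularPointedDerivator DiagramDomain.Shape.IsFinite) ∧
    (D.IsRegular DiagramDomain.Shape.IsFiniteDirect →
      D.Sp.IsRegularPointedDerivator DiagramDomain.Shape.IsFiniteDirect) :=
  ⟨hD.isRegularPointedDerivator_vanishing _, hD.isRegularPointedDerivator_vanishing _⟩
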